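/- **Setting.** Consider a deterministic episodic MDP with horizon $H\ge 1$: a measurable state space $\mathcal S$, split measurably into disjoint layers $\mathcal S_1,\dots,\mathcal S_H$; a finite action space $\mathcal A$; measurable transitions $s_{h+1}=T(s_h,a_h)$ that map $\mathcal S_h\times\mathcal A$ into $\mathcal S_{h+1}$ for $h<H$; a measurable reward $r:\mathcal S\times\mathcal A\to\mathbb R$; and an initial distribution $\rho$ on $\mathcal S_1$. A policy is a measurable map $\pi:\mathcal S\to\Delta(\mathcal A)$. It induces a law on trajectories $\tau=(s_1,a_1,\dots,s_H,a_H)$ through $s_1\sim\rho$, $a_h\sim\pi(\cdot\mid s_h)$, $s_{h+1}=T(s_h,a_h)$, and $d_h^\pi$ denotes the law of $(s_h,a_h)$. Put $r(\tau)=\sum_{h=1}^H r(s_h,a_h)$. Fix $\beta>0$ and a reference policy $\pi_{\mathsf{ref}}$ that is everywhere positive, and let $$J_\beta(\pi)=\mathbb E_{\tau\sim\pi}\Big[\sum_{h=1}^H\Big(r(s_h,a_h)-\beta\log\frac{\pi(a_h\mid s_h)}{\pi_{\mathsf{ref}}(a_h\mid s_h)}\Big)\Big],\qquad R_\beta(s,a)=\frac{r(s,a)}\beta+\log\pi_{\mathsf{ref}}(a\mid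 s).$$ Let $\pi^\star$ be a policy that maximizes $J_\beta$ over all policies, and for $s\in\mathcal S_h$, $a\in\mathcal A$ let $$Q^\star(s,a)=\mathbb E_{\pi^\star}\Big[R_\beta(s_h,a_h)+\sum_{h'=h+1}^H\big(R_\beta(s_{h'},a_{h'})-\log\pi^\star(a_{h'}\mid s_{h'})\big)\,\Big|\,(s_h,a_h)=(s,a)\Big].$$ **Parametrization.** Let $\Theta\subseteq\mathbb R^d$, where $\mathbb R^d$ carries an arbitrary norm $\|\cdot\|$ with dual norm $\|\cdot\|_*$, and let $\mathrm{logit}_\theta:\mathcal S\times\mathcal A\to\mathbb R$ be given, measurable for each $\theta\in\Theta$. Put $Q_\theta=\mathrm{logit}_\theta$ and $\pi_\theta(a\mid s)=e^{Q_\theta(s,a)}/\sum_{a'\in\mathcal A}e^{Q_\theta(s,a')}$. Assume: 1. (realizability) there is $\theta^\star\in\Theta$ with $Q_{\theta^\star}=Q^\star$ on $\mathcal S\times\mathcal A$; 2. (bounded and smooth parametrization) for some $C_\Theta\ge1$ and $L_\Theta$, and all $s\in\mathcal S$, $a\in\mathcal A$: $|\mathrm{logit}_\theta(s,a)|\le C_\Theta/\beta$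 for $\theta\in\Theta$; $|\log\pi_{\mathsf{ref}}(a\mid s)|\le C_\Theta/\beta$; and $\theta\mapsto\mathrm{logit}_\theta(s,a)$ is differentiable relative to the convex hull of $\Theta$ with $\|\nabla_\theta\mathrm{logit}_\theta(s,a)\|_*\le L_\Theta$ at every point of that hull (which is $\Theta$ itself if $\Theta$ is convex); 3. (parametric class) $\|\theta\|\le R$ for all $\theta\in\Theta$; write $\dim(\Theta)=d$. **Data.** Let $\mathcal D$ consist of $|\mathcal D|=N\ge1$ i.i.d. trajectories drawn by following a policy $\mu$, let $$\mathcal L^{\mathsf{TBRM}}_{\mathcal D}(\theta)=\frac1N\sum_{\tau\in\mathcal D}\Big(\mathrm{logit}_\theta(s_1,a_1)-\frac{r(\tau)}\beta-\sum_{h=1}^H\log\pi_{\mathsf{ref}}(a_h\mid s_h)+\sum_{h=2}^H\log\pi_\theta(a_h\mid s_h)\Big)^2,$$ and let $$C_{\chi^2}(\mu)=1+\sup_{\theta\in\Theta}\max_{1\le h\le H}\chi^2\big(d_h^{\pi_\theta}\,\|\,d_h^\mu\big),$$ assumed finite, where $\chi^2(P\|Q)=\mathbb E_P[dP/dQ]-1$,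 read as $\infty$ if $P\not\ll Q$. **Theorem.** There is an absolute constant $c>0$ such that in every such setting and for every $\delta\in(0,1)$, with probability at least $1-\delta$ over $\mathcal D$, the following holds for all $\widehat\theta\in\Theta$ and all $\varepsilon_{\mathsf{opt}}$ with $\mathcal L^{\mathsf{TBRM}}_{\mathcal D}(\widehat\theta)-\inf_{\theta\in\Theta}\mathcal L^{\mathsf{TBRM}}_{\mathcal D}(\theta)\le\varepsilon_{\mathsf{opt}}$: $$J_\beta(\pi^\star)-J_\beta(\pi_{\widehat\theta})\;\le\; c\,\sqrt{H\,C_{\chi^2}(\mu)\Big(\beta^2\varepsilon_{\mathsf{opt}}+C_\Theta^2\,\frac{H^2\dim(\Theta)}{|\mathcal D|}\,\log\frac{e\,(1+R\,L_\Theta\,\beta H|\mathcal D|)}{\delta}\Big)}.$$ -/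

import Mathlib

open MeasureTheory
open scoped ENNReal

noncomputable section

/-- A deterministic episodic Markov decision process with horizon `H`, state space `S` and finite
action space `A`. The state space is layered: `layer s = h` says that `s` is a state of step `h + 1`
(steps are numbered from `0` here). The value of `next` on the last layer is never used. -/
structure DetMDP (S A : Type*) [MeasurableSpace S] (H : ℕ) where
  layer : S → Fin H
  next : S → A → S
  reward : S → A → ℝ
  init : Measure S
  isProbabilityMeasure_init : IsProbabilityMeasure init
  measurable_layer : Measurable layer
  measurable_next : ∀ a, Measurable fun s => next s a
  measurable_reward : ∀ a, Measurable fun s => reward s a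
  layer_init : ∀ᵐ s ∂init, (layer s : ℕ) = 0
  layer_next : ∀ s a, (layer s : ℕ) + 1 < H → (layer (next s a) : ℕ) = layer s + 1

/-- `p s a` is the probability of the action `a` in the state `s` under a (Markov, measurable)
policy. -/
structure IsPolicy {S A : Type*} [MeasurableSpace S] [Fintype A] (p : S → A → ℝ) : Prop where
  nonneg : ∀ s a, 0 ≤ p s a
  sum_eq_one : ∀ s, ∑ a, p s a = 1
  measurable : ∀ a, Measurable fun s => p s a

/-- `V_Q(s) = log ∑ₐ exp Q(s,a)`. -/
def softValue {S A : Type*} [Fintype A] (Q : S → A → ℝ) (s : S) : ℝ :=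
  Real.log (∑ a, Real.exp (Q s a))

/-- The Boltzmann policy `π_Q(a | s) = exp (Q(s,a) - V_Q(s))`. -/
def boltzmann {S A : Type*} [Fintype A] (Q : S → A → ℝ) (s : S) (a : A) : ℝ :=
  Real.exp (Q s a - softValue Q s)

/-- The `χ²`-divergence `E_P[dP/dQ] - 1`, which is `∞` if `P` is not absolutely continuous with
respect to `Q`. -/
def chiSqDiv {X : Type*} [MeasurableSpace X] (P Q : Measure X) : ℝ≥0∞ :=
  open Classical in if P ≪ Q then (∫⁻ x, P.rnDeriv Q x ∂P) - 1 else ∞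

namespace DetMDP

variable {S A : Type*} [MeasurableSpace S] [Fintype A] [MeasurableSpace A] {H : ℕ}

/-- The law of the `n` state-action pairs met when following the policy `p` from the state `s`. -/
def trajFrom (M : DetMDP S A H) (p : S → A → ℝ) : (n : ℕ) → S → Measure (Fin n → S × A)
  | 0, _ => Measure.dirac Fin.elim0
  | n + 1, s => ∑ a, ENNReal.ofReal (p s a) •
      (trajFrom M p n (M.next s a)).map
        (fun t => (Fin.cons (s, a) t : Fin (n + 1) → S × A))

/-- The law of a full trajectory `(s₁, a₁, …, s_H, a_H)` under the policy `p`. -/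
def trajLaw (M : DetMDP S A H) (p : S → A → ℝ) : Measure (Fin H → S × A) :=
  M.init.bind (M.trajFrom p H)

/-- The occupancy measure `d_h^p`: the law of the pair `(s_h, a_h)` under the policy `p`. -/
def occupancy (M : DetMDP S A H) (p : S → A → ℝ) (h : Fin H) : Measure (S × A) :=
  (M.trajLaw p).map fun t => t h

/-- The KL-regularized objective `J_β(p)` with reference policy `ref`. -/
def objective (M : DetMDP S A H) (β : ℝ) (ref p : S → A → ℝ) : ℝ :=
  ∫ t, ∑ h, (M.reward (t h).1 (t h).2
      - β * Real.log (p (t h).1 (t h).2 / ref (t h).1 (t h).2)) ∂(M.trajLaw p)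

/-- The policy `p` maximizes `J_β` over all policies. -/
def IsOptimal (M : DetMDP S A H) (β : ℝ) (ref p : S → A → ℝ) : Prop :=
  IsPolicy p ∧ ∀ q : S → A → ℝ, IsPolicy q → M.objective β ref q ≤ M.objective β ref p

/-- The transformed reward `R_β(s,a) = r(s,a) / β + log ref(a | s)`. -/
def shiftedReward (M : DetMDP S A H) (β : ℝ) (ref : S → A → ℝ) (s : S) (a : A) : ℝ :=
  M.reward s a / β + Real.log (ref s a)

/-- `Q_β^p(s,a)`: the expectation of `R_β(s_h,a_h) + ∑_{h' > h} (R_β - log p)(s_{h'},a_{h'})` given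
`(s_h, a_h) = (s, a)`, where `h` is the layer of `s`. -/
def qValue (M : DetMDP S A H) (β : ℝ) (ref p : S → A → ℝ) (s : S) (a : A) : ℝ :=
  ∫ t, (M.shiftedReward β ref s a
      + ∑ i, (M.shiftedReward β ref (t i).1 (t i).2 - Real.log (p (t i).1 (t i).2)))
    ∂(M.trajFrom p (H - 1 - (M.layer s : ℕ)) (M.next s a))

/-- The trajectory Bellman residual of the logits `Q`,
`Q(s₁,a₁) - r(τ)/β - log ref(τ) + ∑_{h ≥ 2} log π_Q(a_h | s_h)`. -/
def trajResidual (M : DetMDP S A H) [NeZero H] (β : ℝ) (ref Q : S → A → ℝ)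
    (t : Fin H → S × A) : ℝ :=
  Q (t 0).1 (t 0).2 - (∑ h, M.reward (t h).1 (t h).2) / β - ∑ h, Real.log (ref (t h).1 (t h).2)
    + ∑ h ∈ Finset.univ.erase (0 : Fin H), Real.log (boltzmann Q (t h).1 (t h).2)

/-- The empirical TBRM loss of the logits `Q` on the data `D`. -/
def tbrmLoss (M : DetMDP S A H) [NeZero H] (β : ℝ) (ref : S → A → ℝ) {N : ℕ}
    (D : Fin N → Fin H → S × A) (Q : S → A → ℝ) : ℝ :=
  (1 / (N : ℝ)) * ∑ i, (M.trajResidual β ref Q (D i)) ^ 2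

/-- The concentrability coefficient `1 + sup_{θ ∈ Θ} max_h χ²(d_h^{π_θ} ‖ d_h^μ)` of the data
collection policy `mu`. -/
def concentrability (M : DetMDP S A H) {E : Type*} (logit : E → S → A → ℝ) (Θ : Set E)
    (mu : S → A → ℝ) : ℝ≥0∞ :=
  1 + ⨆ θ ∈ Θ, ⨆ h : Fin H,
    chiSqDiv (M.occupancy (boltzmann (logit θ)) h) (M.occupancy mu h)

end DetMDP

end

set_option linter.unusedSectionVars false

namespace DetMDP

/-! ### Expected sums of a cost along a policy. -/

section Cumulative

variable {S A : Type*} [MeasurableSpace S] [Fintype A] {H : ℕ} (M : DetMDP S A H)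
  {p f : S → A → ℝ}

/-! Let V be the log-sum-exp of the logits Q and let e(s,a) = Q - R_β - V(next state) be the Bellman
error. As the next state is a function of the current pair, V telescopes along every trajectory and
not only on average, so the TBRM residual is almost surely the sum of e along the trajectory
(`ae_trajResidual_eq`). In expectation, the same telescoping writes the regularized return of a
policy as V at the start, minus its expected sum of e, minus a relative entropy to the Boltzmann
policy of Q. The suboptimality is thus at most β times a difference of two expected sums of e
(`objective_sub_le`).

These sums must be moved to the data policy μ using state-action concentrability alone. Under μ, the
sum of e is its conditional mean given the first state plus advantages, which form a martingale
difference sequence, so the second moment splits into a sum of squares (`integral_sq_trajLaw`).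
Under another policy, the mean of the sum is the sum of the means of the same pieces
(`cumulative_advantage`). Cauchy-Schwarz in each layer then costs only the χ² coefficient and a
factor 1 + H (`sq_integral_cumulative_le`).

A maximizer of the objective is controlled only where the initial law leads, so the soft Bellman
equation for Q* may fail elsewhere. Its Bellman error is minus the entropy gap of π* at the next
state. Comparison with the Boltzmann policy of Q* makes the gaps vanish along that policy and, by
positivity, along every policy (`objective_boltzmann_eq_and_cumulative_eq_zero`). That Boltzmann
policy is therefore optimal, and the residual of θ* vanishes almost surely.

The regression is therefore noiseless: a multiplicative Chernoff lower-tail bound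
(`measure_pi_sum_lt_le`) over a net of Θ gives mean squared residuals of order 1/N. -/

/-- The expected sum of `f` over the `n` state-action pairs met when following `p` from `s`. -/
noncomputable def cumulative (p f : S → A → ℝ) : ℕ → S → ℝ
  | 0, _ => 0
  | n + 1, s => ∑ a, p s a * (f s a + cumulative p f n (M.next s a))

theorem measurable_cumulative (hp : IsPolicy p) (hf : ∀ a, Measurable fun s => f s a) (n : ℕ) :
    Measurable (M.cumulative p f n) := by
  induction n with
  | zero => exact measurable_const
  | succ n ih =>
    exact Finset.measurable_sum _ fun a _ =>
      (hp.measurable a).mul ((hf a).add (ih.comp (M.measurable_next a)))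

theorem abs_cumulative_le (hp : IsPolicy p) {B : ℝ} (hB : ∀ s, ∑ a, p s a * |f s a| ≤ B)
    (n : ℕ) (s : S) : M.cumulative p (fun s a => |f s a|) n s ≤ n * B := by
  induction n generalizing s with
  | zero => simp [cumulative]
  | succ n ih =>
    simp only [cumulative, mul_add, Finset.sum_add_distrib]
    have h1 : ∑ a, p s a * M.cumulative p (fun s a => |f s a|) n (M.next s a) ≤ n * B :=
      calc _ ≤ ∑ a, p s a * (n * B) := Finset.sum_le_sum fun a _ =>
            mul_le_mul_of_nonneg_left (ih _) (hp.nonneg s a)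
        _ = n * B := by rw [← Finset.sum_mul, hp.sum_eq_one, one_mul]
    push_cast
    linarith [hB s]

end Cumulative

/-! ### Trajectory laws: measurability, integrability and recursion. -/

theorem measurable_consPair {S A : Type*} [MeasurableSpace S] [MeasurableSpace A] (n : ℕ) (a : A) :
    Measurable fun x : S × (Fin n → S × A) => (Fin.cons (x.1, a) x.2 : Fin (n + 1) → S × A) := by
  refine measurable_pi_iff.2 fun i => ?_
  refine Fin.cases ?_ (fun j => ?_) i
  · simpa using measurable_fst.prodMk measurable_const
  · simp only [Fin.cons_succ]
    exact (measurable_pi_apply j).comp measurable_snd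

theorem measurable_consPair_right {S A : Type*} [MeasurableSpace S] [MeasurableSpace A] {n : ℕ} (s : S) (a : A) :
    Measurable fun t : Fin n → S × A => (Fin.cons (s, a) t : Fin (n + 1) → S × A) :=
  (measurable_consPair n a).comp measurable_prodMk_left

section Trajectories

variable {S A : Type*} [MeasurableSpace S] [Fintype A] [MeasurableSpace A]
  [MeasurableSingletonClass A] {H : ℕ} (M : DetMDP S A H) {p f : S → A → ℝ}

theorem measurable_pair {Y : Type*} [MeasurableSpace Y] {f : S → A → Y}
    (hf : ∀ a, Measurable fun s => f s a) : Measurable fun x : S × A => f x.1 x.2 :=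
  measurable_from_prod_countable_left fun a => hf a

theorem isProbabilityMeasure_trajFrom (hp : IsPolicy p) (n : ℕ) (s : S) :
    IsProbabilityMeasure (M.trajFrom p n s) := by
  induction n generalizing s with
  | zero => exact Measure.dirac.isProbabilityMeasure
  | succ n ih =>
    constructor
    simp only [trajFrom, Measure.coe_finsetSum, Measure.coe_smul, Finset.sum_apply, Pi.smul_apply,
      smul_eq_mul]
    have : ∀ a, (M.trajFrom p n (M.next s a)).map
        (fun t => (Fin.cons (s, a) t : Fin (n + 1) → S × A)) Set.univ = 1 := fun a => by
      rw [Measure.map_apply (measurable_consPair_right s a) MeasurableSet.univ, Set.preimage_univ,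
        (ih _).measure_univ]
    simp only [this, mul_one]
    rw [← ENNReal.ofReal_sum_of_nonneg fun a _ => hp.nonneg s a, hp.sum_eq_one, ENNReal.ofReal_one]

theorem measurable_trajFrom (hp : IsPolicy p) (n : ℕ) : Measurable (M.trajFrom p n) := by
  induction n with
  | zero => exact measurable_const
  | succ n ih =>
    refine Measure.measurable_of_measurable_coe _ fun B hB => ?_
    simp only [trajFrom, Measure.coe_finsetSum, Measure.coe_smul, Finset.sum_apply, Pi.smul_apply,
      smul_eq_mul]
    refine Finset.measurable_sum _ fun a _ => (hp.measurable a).ennreal_ofReal.mul ?_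
    let κ : ProbabilityTheory.Kernel S (Fin n → S × A) :=
      ⟨fun s => M.trajFrom p n (M.next s a), ih.comp (M.measurable_next a)⟩
    have : ProbabilityTheory.IsMarkovKernel κ := ⟨fun s => M.isProbabilityMeasure_trajFrom hp n _⟩
    have h := ProbabilityTheory.Kernel.measurable_kernel_prodMk_left (κ := κ)
      (measurable_consPair n a hB)
    convert! h using 2 with s
    rw [Measure.map_apply (measurable_consPair_right s a) hB]
    rfl

/-- The trajectory laws `M.trajFrom p n` as a kernel. -/
noncomputable def trajKernel (hp : IsPolicy p) (n : ℕ) :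
    ProbabilityTheory.Kernel S (Fin n → S × A) :=
  ⟨M.trajFrom p n, M.measurable_trajFrom hp n⟩

instance (hp : IsPolicy p) (n : ℕ) : ProbabilityTheory.IsMarkovKernel (M.trajKernel hp n) :=
  ⟨fun s => M.isProbabilityMeasure_trajFrom hp n s⟩

theorem trajLaw_eq (hp : IsPolicy p) :
    M.trajLaw p = M.init.bind (M.trajKernel hp H) := rfl

theorem isProbabilityMeasure_trajLaw (hp : IsPolicy p) : IsProbabilityMeasure (M.trajLaw p) := by
  have := M.isProbabilityMeasure_init
  rw [M.trajLaw_eq hp]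
  infer_instance

theorem isProbabilityMeasure_occupancy (hp : IsPolicy p) (h : Fin H) :
    IsProbabilityMeasure (M.occupancy p h) := by
  have := M.isProbabilityMeasure_trajLaw hp
  exact Measure.isProbabilityMeasure_map (measurable_pi_apply h).aemeasurable

/-- No bound on `g` is needed: with finitely many actions and deterministic transitions, the law
from a fixed state is a finite combination of Dirac masses. -/
theorem integrable_trajFrom (p : S → A → ℝ) {n : ℕ} {g : (Fin n → S × A) → ℝ} (hg : Measurable g)
    (s : S) : Integrable g (M.trajFrom p n s) := by
  induction n generalizing s with
  | zero => exact integrable_dirac' hg.stronglyMeasurable (by simp)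
  | succ n ih =>
    rw [trajFrom, integrable_finsetSum_measure]
    intro a _
    refine Integrable.smul_measure ?_ ENNReal.ofReal_ne_top
    rw [integrable_map_measure hg.aestronglyMeasurable (measurable_consPair_right s a).aemeasurable]
    exact ih (hg.comp (measurable_consPair_right s a)) _

theorem integral_trajFrom_succ (hp : IsPolicy p) {n : ℕ} {g : (Fin (n + 1) → S × A) → ℝ}
    (hg : Measurable g) (s : S) :
    ∫ t, g t ∂(M.trajFrom p (n + 1) s)
      = ∑ a, p s a * ∫ t, g (Fin.cons (s, a) t) ∂(M.trajFrom p n (M.next s a)) := by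
  have hI : ∀ a ∈ Finset.univ, Integrable g (ENNReal.ofReal (p s a) •
      (M.trajFrom p n (M.next s a)).map
        (fun t => (Fin.cons (s, a) t : Fin (n + 1) → S × A))) := fun a _ => by
    refine Integrable.smul_measure ?_ ENNReal.ofReal_ne_top
    rw [integrable_map_measure hg.aestronglyMeasurable (measurable_consPair_right s a).aemeasurable]
    exact M.integrable_trajFrom p (hg.comp (measurable_consPair_right s a)) _
  rw [trajFrom, integral_finsetSum_measure hI]
  refine Finset.sum_congr rfl fun a _ => ?_
  rw [integral_smul_measure, ENNReal.toReal_ofReal (hp.nonneg s a),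
    integral_map (measurable_consPair_right s a).aemeasurable hg.aestronglyMeasurable, smul_eq_mul]

theorem ae_trajFrom_succ {n : ℕ} {P : (Fin (n + 1) → S × A) → Prop} (hP : MeasurableSet {t | P t})
    (s : S) (h : ∀ a, ∀ᵐ t ∂M.trajFrom p n (M.next s a), P (Fin.cons (s, a) t)) :
    ∀ᵐ t ∂M.trajFrom p (n + 1) s, P t := by
  rw [trajFrom, ae_finsetSum_measure_iff]
  intro a _
  refine Measure.ae_smul_measure ?_ _
  exact (ae_map_iff (measurable_consPair_right s a).aemeasurable hP).2 (h a)

theorem ae_trajLaw (hp : IsPolicy p) {P : (Fin H → S × A) → Prop} (hP : MeasurableSet {t | P t})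
    (h : ∀ᵐ s ∂M.init, ∀ᵐ t ∂M.trajFrom p H s, P t) : ∀ᵐ t ∂M.trajLaw p, P t := by
  have hP' : MeasurableSet {t | ¬P t} := hP.compl
  rw [ae_iff, trajLaw, Measure.bind_apply hP' (M.measurable_trajFrom hp H).aemeasurable]
  refine (lintegral_eq_zero_iff ((Measure.measurable_coe hP').comp
    (M.measurable_trajFrom hp H))).2 ?_
  filter_upwards [h] with s hs using hs

theorem measurable_sum_traj (hf : ∀ a, Measurable fun s => f s a) (n : ℕ) :
    Measurable fun t : Fin n → S × A => ∑ i, f (t i).1 (t i).2 :=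
  Finset.measurable_sum _ fun i _ => (measurable_pair hf).comp (measurable_pi_apply i)

theorem integral_sum_trajFrom (hp : IsPolicy p) (hf : ∀ a, Measurable fun s => f s a)
    (n : ℕ) (s : S) :
    ∫ t, ∑ i, f (t i).1 (t i).2 ∂(M.trajFrom p n s) = M.cumulative p f n s := by
  induction n generalizing s with
  | zero => simp [cumulative]
  | succ n ih =>
    rw [M.integral_trajFrom_succ hp (measurable_sum_traj hf _), cumulative]
    refine Finset.sum_congr rfl fun a _ => ?_
    have := M.isProbabilityMeasure_trajFrom hp n (M.next s a)
    simp only [Fin.sum_univ_succ, Fin.cons_zero, Fin.cons_succ]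
    rw [integral_add (integrable_const _) (M.integrable_trajFrom p (measurable_sum_traj hf _) _), ih]
    simp

theorem integrable_trajLaw (hp : IsPolicy p) {g : (Fin H → S × A) → ℝ} (hg : Measurable g) {B : ℝ}
    (hB : ∀ s, ∫ t, |g t| ∂(M.trajFrom p H s) ≤ B) : Integrable g (M.trajLaw p) := by
  have := M.isProbabilityMeasure_init
  rw [M.trajLaw_eq hp, Measure.integrable_comp_iff hg.aestronglyMeasurable]
  refine ⟨Filter.Eventually.of_forall fun s => M.integrable_trajFrom p hg s, ?_⟩
  refine Integrable.of_bound (C := B) ?_ (Filter.Eventually.of_forall fun s => ?_)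
  · exact (hg.norm.stronglyMeasurable.integral_kernel (κ := M.trajKernel hp H)).aestronglyMeasurable
  · rw [Real.norm_of_nonneg (integral_nonneg fun t => norm_nonneg _)]
    exact hB s

theorem integral_trajLaw (hp : IsPolicy p) {g : (Fin H → S × A) → ℝ}
    (hg : Integrable g (M.trajLaw p)) :
    ∫ t, g t ∂(M.trajLaw p) = ∫ s, ∫ t, g t ∂(M.trajFrom p H s) ∂M.init := by
  rw [M.trajLaw_eq hp] at hg ⊢
  rw [Measure.comp_eq_comp_const_apply] at hg ⊢
  rw [ProbabilityTheory.Kernel.integral_comp hg]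
  rfl

theorem integrable_sum_trajLaw (hp : IsPolicy p) (hf : ∀ a, Measurable fun s => f s a) {B : ℝ}
    (hB : ∀ s, ∑ a, p s a * |f s a| ≤ B) :
    Integrable (fun t => ∑ i, f (t i).1 (t i).2) (M.trajLaw p) := by
  have hf' : ∀ a, Measurable fun s => |f s a| := fun a => (hf a).norm
  refine M.integrable_trajLaw hp (measurable_sum_traj hf H) (B := H * B) fun s => ?_
  refine le_trans ?_ (M.abs_cumulative_le hp hB H s)
  rw [← M.integral_sum_trajFrom hp hf' H s]
  exact integral_mono (M.integrable_trajFrom p (measurable_sum_traj hf H).norm s)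
    (M.integrable_trajFrom p (measurable_sum_traj hf' H) s)
    fun t => Finset.abs_sum_le_sum_abs _ _

theorem integral_sum_trajLaw (hp : IsPolicy p) (hf : ∀ a, Measurable fun s => f s a) {B : ℝ}
    (hB : ∀ s, ∑ a, p s a * |f s a| ≤ B) :
    ∫ t, ∑ i, f (t i).1 (t i).2 ∂(M.trajLaw p) = ∫ s, M.cumulative p f H s ∂M.init := by
  rw [M.integral_trajLaw hp (M.integrable_sum_trajLaw hp hf hB)]
  exact integral_congr_ae (Filter.Eventually.of_forall fun s => M.integral_sum_trajFrom hp hf H s)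

end Trajectories

end DetMDP

/-! ### Log-sum-exp values, Boltzmann policies and the entropy gap. -/

section Boltzmann

variable {S A : Type*} [Fintype A] {Q : S → A → ℝ}

theorem sum_exp_pos [Nonempty A] (Q : S → A → ℝ) (s : S) : 0 < ∑ a, Real.exp (Q s a) :=
  Finset.sum_pos (fun _ _ => Real.exp_pos _) Finset.univ_nonempty

theorem log_boltzmann (Q : S → A → ℝ) (s : S) (a : A) :
    Real.log (boltzmann Q s a) = Q s a - softValue Q s := by
  rw [boltzmann, Real.log_exp]

theorem boltzmann_pos (Q : S → A → ℝ) (s : S) (a : A) : 0 < boltzmann Q s a := Real.exp_pos _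

theorem sum_boltzmann [Nonempty A] (Q : S → A → ℝ) (s : S) : ∑ a, boltzmann Q s a = 1 := by
  simp only [boltzmann, Real.exp_sub, softValue, Real.exp_log (sum_exp_pos Q s)]
  rw [← Finset.sum_div, div_self (sum_exp_pos Q s).ne']

theorem measurable_softValue [MeasurableSpace S] (hQ : ∀ a, Measurable fun s => Q s a) :
    Measurable (softValue Q) :=
  Real.measurable_log.comp (Finset.measurable_sum _ fun a _ => Real.measurable_exp.comp (hQ a))

theorem isPolicy_boltzmann [MeasurableSpace S] [Nonempty A] (hQ : ∀ a, Measurable fun s => Q s a) :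
    IsPolicy (boltzmann Q) :=
  ⟨fun s a => (boltzmann_pos Q s a).le, sum_boltzmann Q,
    fun a => Real.measurable_exp.comp ((hQ a).sub (measurable_softValue hQ))⟩

/-- Log-sum-exp is monotone and commutes with adding constants, hence is 1-Lipschitz in the sup
norm. -/
theorem softValue_le_add [Nonempty A] {Q Q' : S → A → ℝ} {s : S} {η : ℝ}
    (h : ∀ a, Q s a ≤ Q' s a + η) : softValue Q s ≤ softValue Q' s + η := by
  rw [softValue, softValue, Real.log_le_iff_le_exp (sum_exp_pos Q s), Real.exp_add,
    Real.exp_log (sum_exp_pos Q' s), Finset.sum_mul]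
  refine Finset.sum_le_sum fun a _ => ?_
  rw [← Real.exp_add]
  exact Real.exp_le_exp.2 (h a)

theorem abs_softValue_sub_le [Nonempty A] {Q Q' : S → A → ℝ} {s : S} {η : ℝ}
    (h : ∀ a, |Q s a - Q' s a| ≤ η) : |softValue Q s - softValue Q' s| ≤ η := by
  have h1 := softValue_le_add (Q := Q) (Q' := Q') (s := s) (η := η)
    fun a => by linarith [(abs_le.1 (h a)).2]
  have h2 := softValue_le_add (Q := Q') (Q' := Q) (s := s) (η := η)
    fun a => by linarith [(abs_le.1 (h a)).1]
  exact abs_le.2 ⟨by linarith, by linarith⟩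

theorem abs_softValue_le [Nonempty A] {s : S} {B : ℝ} (h : ∀ a, |Q s a| ≤ B) :
    |softValue Q s| ≤ B + Real.log (Fintype.card A) := by
  have h0 : softValue (fun (_ : S) (_ : A) => (0 : ℝ)) s = Real.log (Fintype.card A) := by
    simp [softValue]
  have h1 := abs_softValue_sub_le (Q := Q) (Q' := fun _ _ => 0) (s := s) (η := B) (by simpa using h)
  rw [h0] at h1
  have h2 : 0 ≤ Real.log (Fintype.card A) := Real.log_natCast_nonneg _
  rw [abs_le] at h1 ⊢
  constructor <;> linarith

/-- The relative entropy of `p (· | s)` with respect to the Boltzmann policy of `Q`. -/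
noncomputable def klGap (p Q : S → A → ℝ) (s : S) : ℝ :=
  ∑ a, p s a * (Real.log (p s a) - (Q s a - softValue Q s))

/-- This is log u ≤ u - 1 at u = y / x, multiplied by x. Summed over actions it becomes the Gibbs
inequality. -/
theorem sub_le_mul_log_sub_log {x y : ℝ} (hx : 0 ≤ x) (hy : 0 < y) :
    x - y ≤ x * (Real.log x - Real.log y) := by
  rcases hx.eq_or_lt with rfl | hx
  · simpa using hy.le
  · have h := Real.log_le_sub_one_of_pos (div_pos hy hx)
    rw [Real.log_div hy.ne' hx.ne'] at h
    have h2 := mul_le_mul_of_nonneg_left h hx.le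
    have h3 : x * (y / x - 1) = y - x := by field_simp
    linarith

theorem klGap_nonneg [Nonempty A] [MeasurableSpace S] {p : S → A → ℝ} (hp : IsPolicy p)
    (Q : S → A → ℝ) (s : S) : 0 ≤ klGap p Q s :=
  calc (0 : ℝ) = ∑ a, (p s a - boltzmann Q s a) := by
        rw [Finset.sum_sub_distrib, hp.sum_eq_one, sum_boltzmann, sub_self]
    _ ≤ klGap p Q s := Finset.sum_le_sum fun a _ => by
        rw [← log_boltzmann]
        exact sub_le_mul_log_sub_log (hp.nonneg s a) (boltzmann_pos Q s a)

theorem klGap_boltzmann (Q : S → A → ℝ) (s : S) : klGap (boltzmann Q) Q s = 0 := by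
  simp [klGap, log_boltzmann]

end Boltzmann

namespace IsPolicy

variable {S A : Type*} [MeasurableSpace S] [Fintype A] {p : S → A → ℝ}

theorem le_one (hp : IsPolicy p) (s : S) (a : A) : p s a ≤ 1 := by
  rw [← hp.sum_eq_one s]
  exact Finset.single_le_sum (fun a _ => hp.nonneg s a) (Finset.mem_univ a)

theorem sum_mul_abs_le (hp : IsPolicy p) {f : S → A → ℝ} {B : ℝ} {s : S}
    (h : ∀ a, |f s a| ≤ B) : ∑ a, p s a * |f s a| ≤ B :=
  calc _ ≤ ∑ a, p s a * B :=
        Finset.sum_le_sum fun a _ => mul_le_mul_of_nonneg_left (h a) (hp.nonneg s a)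
    _ = B := by rw [← Finset.sum_mul, hp.sum_eq_one, one_mul]

/-- Since |x log x| < 1 on (0,1], entropy terms are integrable although `log p` is unbounded. -/
theorem sum_mul_abs_log_le (hp : IsPolicy p) (s : S) :
    ∑ a, p s a * |Real.log (p s a)| ≤ Fintype.card A := by
  calc _ ≤ ∑ _a : A, (1 : ℝ) := Finset.sum_le_sum fun a _ => by
        rcases (hp.nonneg s a).eq_or_lt with h | h
        · simp [← h]
        · have := Real.abs_log_mul_self_lt _ h (hp.le_one s a)
          rw [abs_mul, abs_of_pos h, mul_comm] at this
          exact this.le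
    _ = Fintype.card A := by simp

theorem sum_mul_abs_sub_log_le (hp : IsPolicy p) {f : S → A → ℝ} {B : ℝ} {s : S}
    (h : ∀ a, |f s a| ≤ B) :
    ∑ a, p s a * |f s a - Real.log (p s a)| ≤ B + Fintype.card A := by
  refine le_trans ?_ (add_le_add (hp.sum_mul_abs_le h) (hp.sum_mul_abs_log_le s))
  rw [← Finset.sum_add_distrib]
  refine Finset.sum_le_sum fun a _ => ?_
  rw [← mul_add]
  exact mul_le_mul_of_nonneg_left (abs_sub _ _) (hp.nonneg s a)

end IsPolicy

namespace DetMDP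

/-! ### Backward induction over layers. -/

section Layers

variable {S A : Type*} [MeasurableSpace S] {H : ℕ} (M : DetMDP S A H)

/-- A function of the state at the next step, or `0` on the last layer. -/
def nextStep (V : S → ℝ) (s : S) (a : A) : ℝ :=
  if (M.layer s : ℕ) + 1 < H then V (M.next s a) else 0

theorem measurable_nextStep {V : S → ℝ} (hV : Measurable V) (a : A) :
    Measurable fun s => M.nextStep V s a := by
  refine Measurable.ite ?_ (hV.comp (M.measurable_next a)) measurable_const
  exact M.measurable_layer (MeasurableSet.of_discrete (s := {i : Fin H | (i : ℕ) + 1 < H}))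

theorem nextStep_of_lt (V : S → ℝ) {n : ℕ} {s : S} (h : (M.layer s : ℕ) + (n + 2) = H) (a : A) :
    M.nextStep V s a = V (M.next s a) := if_pos (by omega)

theorem nextStep_last (V : S → ℝ) {s : S} (h : (M.layer s : ℕ) + 1 = H) (a : A) :
    M.nextStep V s a = 0 := if_neg (by omega)

theorem layer_next_add {n : ℕ} {s : S} (h : (M.layer s : ℕ) + (n + 2) = H) (a : A) :
    (M.layer (M.next s a) : ℕ) + (n + 1) = H := by
  rw [M.layer_next s a (by omega)]; omega

/-- Backward induction over the remaining number of steps. -/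
theorem stage_induction {P : ℕ → S → Prop}
    (last : ∀ s, (M.layer s : ℕ) + 1 = H → P 1 s)
    (step : ∀ n s, (M.layer s : ℕ) + (n + 2) = H → (∀ a, P (n + 1) (M.next s a)) → P (n + 2) s)
    (n : ℕ) (s : S) (h : (M.layer s : ℕ) + n = H) : P n s := by
  obtain _ | n := n
  · exact absurd (M.layer s).2 (by omega)
  induction n generalizing s with
  | zero => exact last s h
  | succ n ih => exact step n s h fun a => ih _ (M.layer_next_add h a)

end Layers

/-! ### Telescoping and the Bellman error decomposition. -/

section Cumulative

variable {S A : Type*} [MeasurableSpace S] [Fintype A] {H : ℕ} (M : DetMDP S A H)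
  {p f g : S → A → ℝ}

/-- Agreement is asked only after weighting by `p`, so that logarithms may be split where `p s a =
0`. -/
theorem cumulative_congr (h : ∀ s a, p s a * f s a = p s a * g s a) (n : ℕ) (s : S) :
    M.cumulative p f n s = M.cumulative p g n s := by
  induction n generalizing s with
  | zero => rfl
  | succ n ih => simp only [cumulative, mul_add, h, ih]

theorem cumulative_add (p f g : S → A → ℝ) (n : ℕ) (s : S) :
    M.cumulative p (fun s a => f s a + g s a) n s
      = M.cumulative p f n s + M.cumulative p g n s := by
  induction n generalizing s with
  | zero => simp [cumulative]
  | succ n ih =>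
    simp only [cumulative, ih, ← Finset.sum_add_distrib]
    exact Finset.sum_congr rfl fun a _ => by ring

theorem cumulative_const_mul (c : ℝ) (p f : S → A → ℝ) (n : ℕ) (s : S) :
    M.cumulative p (fun s a => c * f s a) n s = c * M.cumulative p f n s := by
  induction n generalizing s with
  | zero => simp [cumulative]
  | succ n ih =>
    simp only [cumulative, ih, Finset.mul_sum]
    exact Finset.sum_congr rfl fun a _ => by ring

theorem cumulative_nonneg (hp : IsPolicy p) (hf : ∀ s, 0 ≤ ∑ a, p s a * f s a) (n : ℕ) (s : S) :
    0 ≤ M.cumulative p f n s := by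
  induction n generalizing s with
  | zero => exact le_rfl
  | succ n ih =>
    simp only [cumulative, mul_add, Finset.sum_add_distrib]
    exact add_nonneg (hf s) (Finset.sum_nonneg fun a _ => mul_nonneg (hp.nonneg s a) (ih _))

theorem cumulative_eq_zero (hf : ∀ s, ∑ a, p s a * f s a = 0) (n : ℕ) (s : S) :
    M.cumulative p f n s = 0 := by
  induction n generalizing s with
  | zero => rfl
  | succ n ih => simp only [cumulative, ih, add_zero, hf]

theorem abs_cumulative_le_of_sum_le (hp : IsPolicy p) {B : ℝ}
    (hB : ∀ s, ∑ a, p s a * |f s a| ≤ B) (n : ℕ) (s : S) :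
    |M.cumulative p f n s| ≤ n * B := by
  refine le_trans ?_ (M.abs_cumulative_le hp hB n s)
  induction n generalizing s with
  | zero => simp [cumulative]
  | succ n ih =>
    refine (Finset.abs_sum_le_sum_abs _ _).trans (Finset.sum_le_sum fun a _ => ?_)
    rw [abs_mul, abs_of_nonneg (hp.nonneg s a)]
    exact mul_le_mul_of_nonneg_left
      ((abs_add_le _ _).trans (add_le_add le_rfl (ih _))) (hp.nonneg s a)

/-- If a nonnegative cost vanishes along an everywhere positive policy, then it vanishes along
every policy. -/
theorem cumulative_eq_zero_of_pos {q : S → A → ℝ} (hp : ∀ s a, 0 < p s a) (hf : ∀ s a, 0 ≤ f s a)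
    (n : ℕ) (s : S) (h : M.cumulative p f n s = 0) : M.cumulative q f n s = 0 := by
  have hnn : ∀ n s, 0 ≤ M.cumulative p f n s := fun n => by
    induction n with
    | zero => exact fun _ => le_rfl
    | succ n ih =>
      exact fun s => Finset.sum_nonneg fun a _ =>
        mul_nonneg (hp s a).le (add_nonneg (hf s a) (ih _))
  induction n generalizing s with
  | zero => rfl
  | succ n ih =>
    refine Finset.sum_eq_zero fun a _ => ?_
    have h1 := (Finset.sum_eq_zero_iff_of_nonneg fun a _ =>
      mul_nonneg (hp s a).le (add_nonneg (hf s a) (hnn n _))).1 h a (Finset.mem_univ a)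
    have h2 := (mul_eq_zero.1 h1).resolve_left (hp s a).ne'
    have h3 := hf s a
    have h4 := hnn n (M.next s a)
    rw [ih _ (by linarith), show f s a = 0 by linarith]
    simp

theorem cumulative_telescope (hp : IsPolicy p) (V : S → ℝ) (n : ℕ) (s : S)
    (h : (M.layer s : ℕ) + n = H) :
    M.cumulative p (fun s a => V s - M.nextStep V s a) n s = V s := by
  refine M.stage_induction (P := fun n s => M.cumulative p (fun s a => V s - M.nextStep V s a) n s
    = V s) (fun s hs => ?_) (fun n s hs ih => ?_) n s h
  · simp [cumulative, M.nextStep_last V hs, ← Finset.sum_mul, hp.sum_eq_one]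
  · rw [cumulative]
    simp only [ih, M.nextStep_of_lt V hs, sub_add_cancel]
    rw [← Finset.sum_mul, hp.sum_eq_one, one_mul]

/-- The Bellman error of the logits `Q`. -/
noncomputable def bellmanError (M : DetMDP S A H) (β : ℝ) (ref Q : S → A → ℝ) (s : S) (a : A) : ℝ :=
  Q s a - M.shiftedReward β ref s a - M.nextStep (softValue Q) s a

/-- Pointwise, R_β - log p = (V - V(next)) - e - (log p - (Q - V)). The first bracket telescopes to
V at the start, and the last one averages to the entropy gap. -/
theorem cumulative_entropy (hp : IsPolicy p) (β : ℝ) (ref Q : S → A → ℝ) (n : ℕ) (s : S)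
    (h : (M.layer s : ℕ) + n = H) :
    M.cumulative p (fun s a => M.shiftedReward β ref s a - Real.log (p s a)) n s
      = softValue Q s - M.cumulative p (M.bellmanError β ref Q) n s
        - M.cumulative p (fun s a => Real.log (p s a) - (Q s a - softValue Q s)) n s := by
  rw [← M.cumulative_telescope hp (softValue Q) n s h, eq_sub_iff_add_eq, eq_sub_iff_add_eq,
    ← cumulative_add, ← cumulative_add]
  congr 1
  funext s a
  rw [bellmanError]
  ring

theorem cumulative_entropy_le [Nonempty A] (hp : IsPolicy p) (β : ℝ) (ref Q : S → A → ℝ) (n : ℕ)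
    (s : S) (h : (M.layer s : ℕ) + n = H) :
    M.cumulative p (fun s a => M.shiftedReward β ref s a - Real.log (p s a)) n s
      ≤ softValue Q s - M.cumulative p (M.bellmanError β ref Q) n s := by
  rw [M.cumulative_entropy hp β ref Q n s h]
  linarith [M.cumulative_nonneg hp (klGap_nonneg hp Q) n s]

theorem cumulative_entropy_boltzmann [Nonempty A] {Q : S → A → ℝ}
    (hQ : ∀ a, Measurable fun s => Q s a) (β : ℝ) (ref : S → A → ℝ) (n : ℕ) (s : S)
    (h : (M.layer s : ℕ) + n = H) :
    M.cumulative (boltzmann Q)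
        (fun s a => M.shiftedReward β ref s a - Real.log (boltzmann Q s a)) n s
      = softValue Q s - M.cumulative (boltzmann Q) (M.bellmanError β ref Q) n s := by
  rw [M.cumulative_entropy (isPolicy_boltzmann hQ) β ref Q n s h,
    M.cumulative_eq_zero (klGap_boltzmann Q), sub_zero]

theorem measurable_shiftedReward {ref : S → A → ℝ} (href : IsPolicy ref) (β : ℝ) (a : A) :
    Measurable fun s => M.shiftedReward β ref s a :=
  ((M.measurable_reward a).div_const β).add (Real.measurable_log.comp (href.measurable a))

theorem measurable_bellmanError {ref Q : S → A → ℝ} (href : IsPolicy ref) (β : ℝ)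
    (hQ : ∀ a, Measurable fun s => Q s a) (a : A) :
    Measurable fun s => M.bellmanError β ref Q s a :=
  ((hQ a).sub (M.measurable_shiftedReward href β a)).sub
    (M.measurable_nextStep (measurable_softValue hQ) a)

end Cumulative

/-! ### Optimality and the soft Bellman equation. -/

section Objective

variable {S A : Type*} [MeasurableSpace S] [Fintype A] [MeasurableSpace A]
  [MeasurableSingletonClass A] {H : ℕ} (M : DetMDP S A H) {β : ℝ} {ref p pstar Q : S → A → ℝ}

theorem ae_layer_add (M : DetMDP S A H) : ∀ᵐ s ∂M.init, (M.layer s : ℕ) + H = H := by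
  filter_upwards [M.layer_init] with s hs
  omega

theorem integrable_init_of_bound {g : S → ℝ} (hg : Measurable g) {B : ℝ} (hB : ∀ s, |g s| ≤ B) :
    Integrable g M.init := by
  have := M.isProbabilityMeasure_init
  exact Integrable.of_bound hg.aestronglyMeasurable B (Filter.Eventually.of_forall hB)

theorem integrable_cumulative (hp : IsPolicy p) {f : S → A → ℝ}
    (hf : ∀ a, Measurable fun s => f s a) {B : ℝ} (hB : ∀ s, ∑ a, p s a * |f s a| ≤ B) (n : ℕ) :
    Integrable (M.cumulative p f n) M.init :=
  M.integrable_init_of_bound (M.measurable_cumulative hp hf n)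
    (M.abs_cumulative_le_of_sum_le hp hB n)

/-- The entropy-regularized reward of a step under the policy `p`. -/
noncomputable def entropyReward (M : DetMDP S A H) (β : ℝ) (ref p : S → A → ℝ) (s : S) (a : A) :
    ℝ :=
  M.shiftedReward β ref s a - Real.log (p s a)

theorem measurable_entropyReward (href : IsPolicy ref) (hp : IsPolicy p) (a : A) :
    Measurable fun s => M.entropyReward β ref p s a :=
  (M.measurable_shiftedReward href β a).sub (Real.measurable_log.comp (hp.measurable a))

theorem objective_eq (hβ : 0 < β) (href : IsPolicy ref) (hpos : ∀ s a, 0 < ref s a)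
    (hp : IsPolicy p) {B : ℝ} (hB : ∀ s a, |M.shiftedReward β ref s a| ≤ B) :
    M.objective β ref p = β * ∫ s, M.cumulative p (M.entropyReward β ref p) H s ∂M.init := by
  have key : ∀ s a, p s a * (M.reward s a - β * Real.log (p s a / ref s a))
      = p s a * (β * M.entropyReward β ref p s a) := fun s a => by
    rcases (hp.nonneg s a).eq_or_lt with h | h
    · simp [← h]
    · rw [Real.log_div h.ne' (hpos s a).ne', entropyReward, shiftedReward]
      field_simp
      ring
  have hm : ∀ a, Measurable fun s => M.reward s a - β * Real.log (p s a / ref s a) := fun a =>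
    (M.measurable_reward a).sub
      ((Real.measurable_log.comp ((hp.measurable a).div (href.measurable a))).const_mul β)
  have hb : ∀ s, ∑ a, p s a * |M.reward s a - β * Real.log (p s a / ref s a)|
      ≤ β * (B + Fintype.card A) := fun s => by
    refine le_trans (le_of_eq ?_)
      (mul_le_mul_of_nonneg_left (hp.sum_mul_abs_sub_log_le (hB s)) hβ.le)
    rw [Finset.mul_sum]
    refine Finset.sum_congr rfl fun a _ => ?_
    have h1 := congrArg abs (key s a)
    rw [abs_mul, abs_mul (p s a), abs_of_nonneg (hp.nonneg s a), abs_mul β, abs_of_pos hβ] at h1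
    rw [h1, entropyReward]
    ring
  rw [objective, M.integral_sum_trajLaw hp hm hb, ← integral_const_mul]
  refine integral_congr_ae (Filter.Eventually.of_forall fun s => ?_)
  rw [M.cumulative_congr key, cumulative_const_mul]

theorem qValue_eq (href : IsPolicy ref) (hp : IsPolicy p) (s : S) (a : A) :
    M.qValue β ref p s a = M.shiftedReward β ref s a
      + M.cumulative p (M.entropyReward β ref p) (H - 1 - (M.layer s : ℕ)) (M.next s a) := by
  have hm := M.measurable_entropyReward (β := β) href hp
  have := M.isProbabilityMeasure_trajFrom hp (H - 1 - (M.layer s : ℕ)) (M.next s a)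
  rw [← M.integral_sum_trajFrom hp hm, qValue]
  simp only [← entropyReward.eq_def]
  rw [integral_add (integrable_const _) (M.integrable_trajFrom p (measurable_sum_traj hm _) _)]
  simp

theorem cumulative_entropyReward_of_qValue (href : IsPolicy ref) (hp : IsPolicy p)
    (hQ : ∀ s a, Q s a = M.qValue β ref p s a) (n : ℕ) (s : S)
    (h : (M.layer s : ℕ) + (n + 1) = H) :
    M.cumulative p (M.entropyReward β ref p) (n + 1) s = ∑ a, p s a * (Q s a - Real.log (p s a)) := by
  rw [cumulative]
  refine Finset.sum_congr rfl fun a _ => ?_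
  rw [hQ, M.qValue_eq href hp, show H - 1 - (M.layer s : ℕ) = n by omega, entropyReward]
  ring

theorem sum_mul_sub_log_eq (hp : IsPolicy p) (Q : S → A → ℝ) (s : S) :
    ∑ a, p s a * (Q s a - Real.log (p s a)) = softValue Q s - klGap p Q s := by
  have : softValue Q s = ∑ a, p s a * softValue Q s := by
    rw [← Finset.sum_mul, hp.sum_eq_one, one_mul]
  rw [klGap, this, ← Finset.sum_sub_distrib]
  refine Finset.sum_congr rfl fun a _ => ?_
  rw [← this]
  ring

/-- The Q-function of `p` backs up the value of `p` at the next state, which by `sum_mul_sub_log_eq`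
falls short of the soft value by exactly the entropy gap. Optimality plays no role here. -/
theorem bellmanError_of_qValue (href : IsPolicy ref) (hp : IsPolicy p)
    (hQ : ∀ s a, Q s a = M.qValue β ref p s a) (s : S) (a : A) :
    M.bellmanError β ref Q s a = - M.nextStep (klGap p Q) s a := by
  rw [bellmanError, hQ, M.qValue_eq href hp]
  by_cases h : (M.layer s : ℕ) + 1 < H
  · obtain ⟨n, hn⟩ : ∃ n, (M.layer s : ℕ) + (n + 2) = H := ⟨H - 2 - M.layer s, by omega⟩
    rw [show H - 1 - (M.layer s : ℕ) = n + 1 by omega,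
      M.cumulative_entropyReward_of_qValue href hp hQ n _ (M.layer_next_add hn a),
      sum_mul_sub_log_eq hp, M.nextStep_of_lt _ hn, M.nextStep_of_lt _ hn]
    ring
  · have h' : (M.layer s : ℕ) + 1 = H := by have := (M.layer s).2; omega
    rw [show H - 1 - (M.layer s : ℕ) = 0 by omega, M.nextStep_last _ h', M.nextStep_last _ h',
      cumulative]
    ring

/-- Rewards are not assumed bounded. A bound follows because R_β is Q minus a next-state value, and
that value is an average of Q - log p. It serves integrability only, so `Fintype.card A` does not
reach the final estimate. -/
theorem abs_shiftedReward_le_of_qValue (href : IsPolicy ref) (hp : IsPolicy p)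
    (hQ : ∀ s a, Q s a = M.qValue β ref p s a) {B : ℝ} (hB : ∀ s a, |Q s a| ≤ B) (s : S) (a : A) :
    |M.shiftedReward β ref s a| ≤ B + (B + Fintype.card A) := by
  have h0 : 0 ≤ B := (abs_nonneg _).trans (hB s a)
  have h1 : M.shiftedReward β ref s a = Q s a
      - M.cumulative p (M.entropyReward β ref p) (H - 1 - (M.layer s : ℕ)) (M.next s a) := by
    rw [hQ, M.qValue_eq href hp]
    ring
  rw [h1]
  refine (abs_sub _ _).trans (add_le_add (hB s a) ?_)
  by_cases h : (M.layer s : ℕ) + 1 < H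
  · obtain ⟨n, hn⟩ : ∃ n, (M.layer s : ℕ) + (n + 2) = H := ⟨H - 2 - M.layer s, by omega⟩
    rw [show H - 1 - (M.layer s : ℕ) = n + 1 by omega,
      M.cumulative_entropyReward_of_qValue href hp hQ n _ (M.layer_next_add hn a)]
    refine (Finset.abs_sum_le_sum_abs _ _).trans
      (le_trans (le_of_eq ?_) (hp.sum_mul_abs_sub_log_le (hB (M.next s a))))
    refine Finset.sum_congr rfl fun b _ => ?_
    rw [abs_mul, abs_of_nonneg (hp.nonneg _ _)]
  · rw [show H - 1 - (M.layer s : ℕ) = 0 by have := (M.layer s).2; omega, cumulative, abs_zero]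
    positivity

theorem nextStep_nonneg {V : S → ℝ} (hV : ∀ s, 0 ≤ V s) (s : S) (a : A) :
    0 ≤ M.nextStep V s a := by
  rw [nextStep]
  split_ifs
  · exact hV _
  · exact le_rfl

/-- If `Q` is the `Q`-function of an optimal policy, then the Boltzmann policy of `Q` is optimal as
well and almost surely, no policy meets a Bellman error of `Q`. -/
theorem objective_boltzmann_eq_and_cumulative_eq_zero [Nonempty A] (hβ : 0 < β)
    (href : IsPolicy ref) (hpos : ∀ s a, 0 < ref s a) (hopt : M.IsOptimal β ref pstar)
    (hQm : ∀ a, Measurable fun s => Q s a) (hQ : ∀ s a, Q s a = M.qValue β ref pstar s a)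
    {B : ℝ} (hB : ∀ s a, |Q s a| ≤ B) :
    M.objective β ref (boltzmann Q) = M.objective β ref pstar ∧
      ∀ᵐ s ∂M.init, ∀ q : S → A → ℝ,
        M.cumulative q (M.nextStep (klGap pstar Q)) H s = 0 := by
  have hp := hopt.1
  have hb := isPolicy_boltzmann hQm
  have hR := M.abs_shiftedReward_le_of_qValue href hp hQ hB
  set B' := B + (B + (Fintype.card A : ℝ)) with hB'
  have hle := hopt.2 _ hb
  rw [M.objective_eq hβ href hpos hp hR, M.objective_eq hβ href hpos hb hR] at hle ⊢
  have hi : ∀ {q : S → A → ℝ}, IsPolicy q →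
      Integrable (M.cumulative q (M.entropyReward β ref q) H) M.init := fun hq =>
    M.integrable_cumulative hq (M.measurable_entropyReward href hq)
      (fun s => hq.sum_mul_abs_sub_log_le (hR s)) H
  -- The Boltzmann policy gains the entropy gap at the start plus the gaps it meets later. Both are
  -- nonnegative, so optimality of `pstar` forces them to vanish almost surely.
  have hdiff : ∀ᵐ s ∂M.init, M.cumulative (boltzmann Q) (M.entropyReward β ref (boltzmann Q)) H s
      - M.cumulative pstar (M.entropyReward β ref pstar) H s
      = klGap pstar Q s + M.cumulative (boltzmann Q) (M.nextStep (klGap pstar Q)) H s := by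
    filter_upwards [M.ae_layer_add] with s hs
    obtain ⟨n, rfl⟩ : ∃ n, H = n + 1 := ⟨H - 1, by have := (M.layer s).2; omega⟩
    have h1 := M.cumulative_entropy_boltzmann hQm β ref (n + 1) s hs
    have h2 := M.cumulative_entropyReward_of_qValue href hp hQ n s hs
    rw [sum_mul_sub_log_eq hp] at h2
    have h3 : M.cumulative (boltzmann Q) (M.bellmanError β ref Q) (n + 1) s
        = - M.cumulative (boltzmann Q) (M.nextStep (klGap pstar Q)) (n + 1) s := by
      rw [← neg_one_mul, ← cumulative_const_mul]
      refine M.cumulative_congr (fun s a => ?_) _ _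
      rw [M.bellmanError_of_qValue href hp hQ, neg_one_mul]
    have h4 : M.cumulative (boltzmann Q) (M.entropyReward β ref (boltzmann Q)) (n + 1) s
      = softValue Q s - M.cumulative (boltzmann Q) (M.bellmanError β ref Q) (n + 1) s := h1
    rw [h4, h2, h3]
    ring
  have hkl := klGap_nonneg hp Q
  have hcn : ∀ s, 0 ≤ M.cumulative (boltzmann Q) (M.nextStep (klGap pstar Q)) H s :=
    M.cumulative_nonneg hb (fun s => Finset.sum_nonneg fun a _ =>
      mul_nonneg (hb.nonneg s a) (M.nextStep_nonneg hkl s a)) H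
  have hint : ∫ s, (M.cumulative (boltzmann Q) (M.entropyReward β ref (boltzmann Q)) H s
      - M.cumulative pstar (M.entropyReward β ref pstar) H s) ∂M.init ≤ 0 := by
    rw [integral_sub (hi hb) (hi hp)]
    linarith [le_of_mul_le_mul_left hle hβ]
  have hnn : 0 ≤ᵐ[M.init] fun s =>
      M.cumulative (boltzmann Q) (M.entropyReward β ref (boltzmann Q)) H s
      - M.cumulative pstar (M.entropyReward β ref pstar) H s := by
    filter_upwards [hdiff] with s hs
    rw [hs]
    exact add_nonneg (hkl s) (hcn s)
  have heq := hint.antisymm (integral_nonneg_of_ae hnn)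
  have hzero := (integral_eq_zero_iff_of_nonneg_ae hnn ((hi hb).sub (hi hp))).1 heq
  refine ⟨?_, ?_⟩
  · rw [integral_sub (hi hb) (hi hp)] at heq
    rw [sub_eq_zero.1 heq]
  · filter_upwards [hdiff, hzero] with s h1 h2 q
    refine M.cumulative_eq_zero_of_pos (boltzmann_pos Q) (M.nextStep_nonneg hkl) H s ?_
    have h3 : klGap pstar Q s + M.cumulative (boltzmann Q) (M.nextStep (klGap pstar Q)) H s = 0 :=
      h1.symm.trans h2
    linarith [hkl s, hcn s]

end Objective

/-! ### The trajectory residual as a sum of Bellman errors. -/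

section Residual

variable {S A : Type*} [MeasurableSpace S] [Fintype A] [MeasurableSpace A]
  [MeasurableSingletonClass A] {H : ℕ} (M : DetMDP S A H) {β : ℝ} {ref p pstar Q : S → A → ℝ}

/-- Pathwise counterpart of `cumulative_telescope`; determinism of the transitions is essential. -/
theorem ae_sum_sub_nextStep {V : S → ℝ} (hV : Measurable V) (n : ℕ) (s : S)
    (h : (M.layer s : ℕ) + n = H) :
    ∀ᵐ t ∂M.trajFrom p n s, ∑ i, (V (t i).1 - M.nextStep V (t i).1 (t i).2) = V s := by
  have hm : ∀ n s, MeasurableSet {t : Fin n → S × A |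
      ∑ i, (V (t i).1 - M.nextStep V (t i).1 (t i).2) = V s} := fun n s =>
    measurableSet_eq_fun (measurable_sum_traj (fun a => hV.sub (M.measurable_nextStep hV a)) n)
      measurable_const
  refine M.stage_induction (P := fun n s => ∀ᵐ t ∂M.trajFrom p n s,
    ∑ i, (V (t i).1 - M.nextStep V (t i).1 (t i).2) = V s) (fun s hs => ?_)
    (fun n s hs ih => ?_) n s h
  · refine M.ae_trajFrom_succ (hm 1 s) s fun a => Filter.Eventually.of_forall fun t => ?_
    simp [M.nextStep_last V hs]
  · refine M.ae_trajFrom_succ (hm _ s) s fun a => ?_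
    filter_upwards [ih a] with t ht
    rw [Fin.sum_univ_succ]
    simp only [Fin.cons_zero, Fin.cons_succ, ht, M.nextStep_of_lt V hs]
    ring

theorem measurable_trajResidual [NeZero H] (href : IsPolicy ref)
    (hQ : ∀ a, Measurable fun s => Q s a) : Measurable (M.trajResidual β ref Q) := by
  have hl : ∀ a, Measurable fun s => Real.log (boltzmann Q s a) := fun a =>
    Real.measurable_log.comp (Real.measurable_exp.comp ((hQ a).sub (measurable_softValue hQ)))
  refine Measurable.add (Measurable.sub (Measurable.sub ?_ ?_) ?_) ?_
  · exact (measurable_pair hQ).comp (measurable_pi_apply 0)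
  · exact (measurable_sum_traj M.measurable_reward H).div_const β
  · exact measurable_sum_traj (fun a => Real.measurable_log.comp (href.measurable a)) H
  · exact Finset.measurable_sum _ fun h _ => (measurable_pair hl).comp (measurable_pi_apply h)

/-- The residual uses Q at the first step and Q - V at later ones. The sum of V over the later steps
equals the sum of the next-step values in the Bellman errors, by pathwise telescoping. -/
theorem ae_trajResidual_eq [NeZero H] (href : IsPolicy ref) (hp : IsPolicy p)
    (hQ : ∀ a, Measurable fun s => Q s a) :
    ∀ᵐ t ∂M.trajLaw p, M.trajResidual β ref Q t
      = ∑ i, M.bellmanError β ref Q (t i).1 (t i).2 := by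
  have hV := measurable_softValue hQ
  refine M.ae_trajLaw hp (measurableSet_eq_fun (M.measurable_trajResidual href hQ)
    (measurable_sum_traj (M.measurable_bellmanError href β hQ) H)) ?_
  filter_upwards [M.ae_layer_add] with s hs
  have h1 : ∀ᵐ t ∂M.trajFrom p H s, softValue Q (t 0).1 = softValue Q s := by
    obtain ⟨n, rfl⟩ : ∃ n, H = n + 1 := ⟨H - 1, by have := NeZero.pos H; omega⟩
    refine M.ae_trajFrom_succ (measurableSet_eq_fun
      (hV.comp (measurable_fst.comp (measurable_pi_apply 0))) measurable_const) s fun a => ?_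
    exact Filter.Eventually.of_forall fun t => by simp
  filter_upwards [h1, M.ae_sum_sub_nextStep (p := p) hV H s hs] with t h1 h2
  rw [← h1] at h2
  simp only [trajResidual, log_boltzmann, bellmanError, shiftedReward, Finset.sum_sub_distrib,
    Finset.sum_add_distrib, Finset.sum_div] at h2 ⊢
  have h3 := Finset.add_sum_erase Finset.univ (fun i => Q (t i).1 (t i).2) (Finset.mem_univ 0)
  have h4 := Finset.add_sum_erase Finset.univ (fun i => softValue Q (t i).1) (Finset.mem_univ 0)
  linarith

theorem ae_trajResidual_eq_zero [NeZero H] [Nonempty A] (hβ : 0 < β)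
    (href : IsPolicy ref) (hpos : ∀ s a, 0 < ref s a) (hopt : M.IsOptimal β ref pstar)
    (hp : IsPolicy p)
    (hQm : ∀ a, Measurable fun s => Q s a) (hQ : ∀ s a, Q s a = M.qValue β ref pstar s a)
    {B : ℝ} (hB : ∀ s a, |Q s a| ≤ B) :
    ∀ᵐ t ∂M.trajLaw p, M.trajResidual β ref Q t = 0 := by
  have hkl := klGap_nonneg hopt.1 Q
  have hm : ∀ a, Measurable fun s => M.nextStep (klGap pstar Q) s a := fun a => by
    have h := (M.measurable_bellmanError href β hQm a).fun_neg
    simpa only [M.bellmanError_of_qValue href hopt.1 hQ, neg_neg] using h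
  have hz : ∀ᵐ t ∂M.trajLaw p, ∑ i, M.nextStep (klGap pstar Q) (t i).1 (t i).2 = 0 := by
    refine M.ae_trajLaw hp (measurableSet_eq_fun (measurable_sum_traj hm H) measurable_const) ?_
    filter_upwards [(M.objective_boltzmann_eq_and_cumulative_eq_zero hβ href hpos hopt hQm hQ
      hB).2] with s hs
    have h1 := hs p
    rw [← M.integral_sum_trajFrom hp hm] at h1
    exact (integral_eq_zero_iff_of_nonneg (fun t => Finset.sum_nonneg fun i _ =>
      M.nextStep_nonneg hkl _ _) (M.integrable_trajFrom p (measurable_sum_traj hm H) s)).1 h1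
  filter_upwards [hz, M.ae_trajResidual_eq (β := β) href hp hQm] with t h1 h2
  rw [h2]
  simp only [M.bellmanError_of_qValue href hopt.1 hQ, Finset.sum_neg_distrib, h1, neg_zero]

end Residual

end DetMDP

/-! ### Change of measure through χ² and orthogonal advantages. -/

theorem lintegral_rnDeriv_le_one_add_chiSqDiv {X : Type*} [MeasurableSpace X] {P Q : Measure X}
    (hPQ : P ≪ Q) : ∫⁻ x, P.rnDeriv Q x ∂P ≤ 1 + chiSqDiv P Q := by
  rw [chiSqDiv, if_pos hPQ]
  exact le_add_tsub

/-- Cauchy-Schwarz in L²(Q) for `f` times the density dP/dQ, whose second moment is 1 + χ². -/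
theorem sq_integral_le_chiSqDiv_mul {X : Type*} [MeasurableSpace X] {P Q : Measure X}
    [IsProbabilityMeasure P] [IsProbabilityMeasure Q] {f : X → ℝ} (hf : Measurable f)
    (hf2 : Integrable (fun x => f x ^ 2) Q) {K : ℝ≥0∞} (hK : 1 + chiSqDiv P Q ≤ K) (hKt : K ≠ ∞) :
    (∫ x, f x ∂P) ^ 2 ≤ K.toReal * ∫ x, f x ^ 2 ∂Q := by
  have hPQ : P ≪ Q := by
    by_contra h
    rw [chiSqDiv, if_neg h] at hK
    simp_all
  have hw : Measurable (P.rnDeriv Q) := Measure.measurable_rnDeriv P Q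
  have h1 : ‖∫ x, f x ∂P‖ₑ ≤ ∫⁻ x, P.rnDeriv Q x * ‖f x‖ₑ ∂Q :=
    (enorm_integral_le_lintegral_enorm f).trans_eq
      (lintegral_rnDeriv_mul hPQ hf.enorm.aemeasurable).symm
  have h2 := ENNReal.lintegral_mul_le_Lp_mul_Lq Q Real.HolderConjugate.two_two hw.aemeasurable
    hf.enorm.aemeasurable
  have h3 : ∫⁻ x, P.rnDeriv Q x ^ (2 : ℝ) ∂Q ≤ K := by
    refine le_trans (le_of_eq ?_) ((lintegral_rnDeriv_le_one_add_chiSqDiv hPQ).trans hK)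
    rw [← lintegral_rnDeriv_mul hPQ hw.aemeasurable]
    simp only [ENNReal.rpow_two, sq]
  have h4 : ∫⁻ x, ‖f x‖ₑ ^ (2 : ℝ) ∂Q = ENNReal.ofReal (∫ x, f x ^ 2 ∂Q) := by
    rw [ofReal_integral_eq_lintegral_ofReal hf2 (Filter.Eventually.of_forall fun x => sq_nonneg _)]
    refine lintegral_congr fun x => ?_
    rw [ENNReal.rpow_two, ← sq_abs, ENNReal.ofReal_pow (abs_nonneg _), ← Real.enorm_eq_ofReal_abs]
  have h5 : ‖∫ x, f x ∂P‖ₑ ^ 2 ≤ K * ENNReal.ofReal (∫ x, f x ^ 2 ∂Q) := by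
    rw [h4] at h2
    have h6 := pow_le_pow_left' (h1.trans h2) 2
    refine h6.trans ?_
    rw [mul_pow, ← ENNReal.rpow_two, ← ENNReal.rpow_two, ← ENNReal.rpow_mul, ← ENNReal.rpow_mul]
    norm_num
    exact mul_le_mul_left (by simpa only [ENNReal.rpow_two] using h3) _
  have h7 := ENNReal.toReal_mono (ENNReal.mul_ne_top hKt ENNReal.ofReal_ne_top) h5
  rw [ENNReal.toReal_mul, ENNReal.toReal_ofReal (integral_nonneg fun x => sq_nonneg _),
    ENNReal.toReal_pow, toReal_enorm, Real.norm_eq_abs, sq_abs] at h7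
  exact h7

namespace DetMDP

section ChangeOfMeasure

variable {S A : Type*} [MeasurableSpace S] [Fintype A] [MeasurableSpace A]
  [MeasurableSingletonClass A] {H : ℕ} (M : DetMDP S A H) {p q f : S → A → ℝ}

/-- The advantage of the action `a` in the state `s` for the cumulative cost `f` along `p`. -/
noncomputable def advantage (M : DetMDP S A H) (p f : S → A → ℝ) (s : S) (a : A) : ℝ :=
  f s a + M.cumulative p f (H - 1 - (M.layer s : ℕ)) (M.next s a)
    - M.cumulative p f (H - (M.layer s : ℕ)) s

theorem advantage_eq (p f : S → A → ℝ) {n : ℕ} {s : S} (h : (M.layer s : ℕ) + (n + 1) = H) (a : A) :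
    M.advantage p f s a
      = f s a + M.cumulative p f n (M.next s a) - M.cumulative p f (n + 1) s := by
  rw [advantage, show H - 1 - (M.layer s : ℕ) = n by omega,
    show H - (M.layer s : ℕ) = n + 1 by omega]

theorem measurable_advantage (hp : IsPolicy p) (hf : ∀ a, Measurable fun s => f s a) (a : A) :
    Measurable fun s => M.advantage p f s a := by
  -- The number of remaining steps depends on the state, but only through its layer, which takes
  -- finitely many values.
  have h : ∀ φ : Fin H → ℕ, Measurable fun x : S × Fin H => M.cumulative p f (φ x.2) x.1 :=
    fun φ => measurable_from_prod_countable_left fun i => M.measurable_cumulative hp hf (φ i)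
  refine ((hf a).add ?_).sub ?_
  · exact (h fun i => H - 1 - (i : ℕ)).comp ((M.measurable_next a).prodMk M.measurable_layer)
  · exact (h fun i => H - (i : ℕ)).comp (measurable_id.prodMk M.measurable_layer)

theorem abs_advantage_le (hp : IsPolicy p) {B : ℝ} (hB : ∀ s a, |f s a| ≤ B) (s : S) (a : A) :
    |M.advantage p f s a| ≤ B + H * B + H * B := by
  have h0 : 0 ≤ B := (abs_nonneg _).trans (hB s a)
  have hc : ∀ n ≤ H, ∀ s, |M.cumulative p f n s| ≤ H * B := fun n hn s =>
    (M.abs_cumulative_le_of_sum_le hp (fun s => hp.sum_mul_abs_le (hB s)) n s).trans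
      (mul_le_mul_of_nonneg_right (by exact_mod_cast hn) h0)
  refine (abs_sub _ _).trans (add_le_add ((abs_add_le _ _).trans (add_le_add (hB s a) ?_)) ?_)
  · exact hc _ (by omega) _
  · exact hc _ (by omega) _

/-- Performance difference identity: the values of `p` telescope along `q`. -/
theorem cumulative_advantage (hq : IsPolicy q) (p f : S → A → ℝ) (n : ℕ) (s : S)
    (h : (M.layer s : ℕ) + n = H) :
    M.cumulative q (M.advantage p f) n s = M.cumulative q f n s - M.cumulative p f n s := by
  refine M.stage_induction (P := fun n s => M.cumulative q (M.advantage p f) n s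
    = M.cumulative q f n s - M.cumulative p f n s) (fun s hs => ?_) (fun n s hs ih => ?_) n s h
  · have h1 : M.cumulative p f 1 s = ∑ a, q s a * M.cumulative p f 1 s := by
      rw [← Finset.sum_mul, hq.sum_eq_one, one_mul]
    rw [h1, cumulative, cumulative, ← Finset.sum_sub_distrib]
    refine Finset.sum_congr rfl fun a _ => ?_
    rw [M.advantage_eq p f (n := 0) hs]
    simp only [cumulative]
    ring
  · have h1 : M.cumulative p f (n + 2) s = ∑ a, q s a * M.cumulative p f (n + 2) s := by
      rw [← Finset.sum_mul, hq.sum_eq_one, one_mul]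
    have h2 : M.cumulative q f (n + 2) s
        = ∑ a, q s a * (f s a + M.cumulative q f (n + 1) (M.next s a)) := rfl
    rw [h1, h2, cumulative, ← Finset.sum_sub_distrib]
    refine Finset.sum_congr rfl fun a _ => ?_
    rw [M.advantage_eq p f (n := n + 1) hs, ih]
    ring

/-- The advantage has mean zero under `p` at each state, so the cross term disappears when the
square is expanded. The free constant `c` carries the cost already accumulated, which the induction
needs. -/
theorem integral_sq_trajFrom_succ (hp : IsPolicy p) (hf : ∀ a, Measurable fun s => f s a)
    {n : ℕ} {s : S} (h : (M.layer s : ℕ) + (n + 1) = H)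
    (ih : ∀ a c, ∫ t, (c + ∑ i, f (t i).1 (t i).2) ^ 2 ∂(M.trajFrom p n (M.next s a))
      = (c + M.cumulative p f n (M.next s a)) ^ 2
        + M.cumulative p (fun s a => M.advantage p f s a ^ 2) n (M.next s a)) (c : ℝ) :
    ∫ t, (c + ∑ i, f (t i).1 (t i).2) ^ 2 ∂(M.trajFrom p (n + 1) s)
      = (c + M.cumulative p f (n + 1) s) ^ 2
        + M.cumulative p (fun s a => M.advantage p f s a ^ 2) (n + 1) s := by
  have hm : Measurable fun t : Fin (n + 1) → S × A => (c + ∑ i, f (t i).1 (t i).2) ^ 2 :=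
    ((measurable_sum_traj hf _).const_add c).pow_const 2
  rw [M.integral_trajFrom_succ hp hm]
  simp only [Fin.sum_univ_succ, Fin.cons_zero, Fin.cons_succ, ← add_assoc, ih]
  have h1 : ∑ a, p s a * M.advantage p f s a = 0 := by
    have h2 : ∀ a, p s a * M.advantage p f s a
        = p s a * (f s a + M.cumulative p f n (M.next s a))
          - p s a * M.cumulative p f (n + 1) s := fun a => by
      rw [M.advantage_eq p f h]
      ring
    rw [Finset.sum_congr rfl fun a _ => h2 a, Finset.sum_sub_distrib, ← Finset.sum_mul,
      hp.sum_eq_one, one_mul, cumulative, sub_self]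
  set G := M.cumulative p f (n + 1) s
  rw [cumulative]
  have h3 : ∀ a, p s a * ((c + f s a + M.cumulative p f n (M.next s a)) ^ 2
      + M.cumulative p (fun s a => M.advantage p f s a ^ 2) n (M.next s a))
      = p s a * (c + G) ^ 2 + 2 * (c + G) * (p s a * M.advantage p f s a)
        + p s a * (M.advantage p f s a ^ 2
          + M.cumulative p (fun s a => M.advantage p f s a ^ 2) n (M.next s a)) := fun a => by
    rw [M.advantage_eq p f h]
    ring
  rw [Finset.sum_congr rfl fun a _ => h3 a, Finset.sum_add_distrib, Finset.sum_add_distrib,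
    ← Finset.sum_mul, ← Finset.mul_sum, h1, hp.sum_eq_one]
  ring

/-- The second moment of a sum along a trajectory splits into that of the value of the initial
state and those of the advantages. -/
theorem integral_sq_trajFrom (hp : IsPolicy p) (hf : ∀ a, Measurable fun s => f s a)
    (n : ℕ) (s : S) (h : (M.layer s : ℕ) + n = H) (c : ℝ) :
    ∫ t, (c + ∑ i, f (t i).1 (t i).2) ^ 2 ∂(M.trajFrom p n s)
      = (c + M.cumulative p f n s) ^ 2
        + M.cumulative p (fun s a => M.advantage p f s a ^ 2) n s := by
  refine M.stage_induction (P := fun n s => ∀ c,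
    ∫ t, (c + ∑ i, f (t i).1 (t i).2) ^ 2 ∂(M.trajFrom p n s) = (c + M.cumulative p f n s) ^ 2
        + M.cumulative p (fun s a => M.advantage p f s a ^ 2) n s) (fun s hs => ?_)
    (fun n s hs ih => ?_) n s h c
  · refine M.integral_sq_trajFrom_succ hp hf hs fun a c => ?_
    have := M.isProbabilityMeasure_trajFrom hp 0 (M.next s a)
    simp [cumulative]
  · exact M.integral_sq_trajFrom_succ hp hf hs ih

theorem integrable_of_bound_trajLaw (hp : IsPolicy p) {g : (Fin H → S × A) → ℝ} (hg : Measurable g)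
    {B : ℝ} (hB : ∀ t, |g t| ≤ B) : Integrable g (M.trajLaw p) := by
  have := M.isProbabilityMeasure_trajLaw hp
  exact Integrable.of_bound hg.aestronglyMeasurable B (Filter.Eventually.of_forall hB)

theorem integral_cumulative_eq_sum_occupancy (hp : IsPolicy p)
    (hf : ∀ a, Measurable fun s => f s a) {B : ℝ} (hB : ∀ s a, |f s a| ≤ B) :
    ∫ s, M.cumulative p f H s ∂M.init = ∑ h, ∫ x, f x.1 x.2 ∂(M.occupancy p h) := by
  rw [← M.integral_sum_trajLaw hp hf fun s => hp.sum_mul_abs_le (hB s), integral_finsetSum]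
  · refine Finset.sum_congr rfl fun h _ => ?_
    rw [occupancy, integral_map (measurable_pi_apply h).aemeasurable
      (measurable_pair hf).aestronglyMeasurable]
  · exact fun i _ => M.integrable_of_bound_trajLaw hp
      ((measurable_pair hf).comp (measurable_pi_apply i)) fun t => hB _ _

theorem integral_sq_trajLaw (hp : IsPolicy p) (hf : ∀ a, Measurable fun s => f s a) {B : ℝ}
    (hB : ∀ s a, |f s a| ≤ B) :
    ∫ t, (∑ i, f (t i).1 (t i).2) ^ 2 ∂(M.trajLaw p)
      = ∫ s, M.cumulative p f H s ^ 2 ∂M.init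
        + ∑ h, ∫ x, M.advantage p f x.1 x.2 ^ 2 ∂(M.occupancy p h) := by
  have hc := M.abs_cumulative_le_of_sum_le hp (fun s => hp.sum_mul_abs_le (hB s)) H
  have ha : ∀ s a, |M.advantage p f s a ^ 2| ≤ (B + H * B + H * B) ^ 2 := fun s a => by
    rw [abs_pow]
    exact pow_le_pow_left₀ (abs_nonneg _) (M.abs_advantage_le hp hB s a) 2
  have ham : ∀ a, Measurable fun s => M.advantage p f s a ^ 2 := fun a =>
    (M.measurable_advantage hp hf a).pow_const 2
  rw [← M.integral_cumulative_eq_sum_occupancy hp ham ha, M.integral_trajLaw hp, ← integral_add]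
  · refine integral_congr_ae ?_
    filter_upwards [M.ae_layer_add] with s hs
    simpa using M.integral_sq_trajFrom hp hf H s hs 0
  · refine M.integrable_init_of_bound ((M.measurable_cumulative hp hf H).pow_const 2)
      (B := (H * B) ^ 2) fun s => ?_
    rw [abs_pow]
    exact pow_le_pow_left₀ (abs_nonneg _) (hc s) 2
  · exact M.integrable_cumulative hp ham (fun s => hp.sum_mul_abs_le (f := fun s a => M.advantage p f s a ^ 2)
      (ha s)) H
  · refine M.integrable_of_bound_trajLaw hp ((measurable_sum_traj hf H).pow_const 2)
      (B := (H * B) ^ 2) fun t => ?_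
    rw [abs_pow]
    refine pow_le_pow_left₀ (abs_nonneg _) ((Finset.abs_sum_le_sum_abs _ _).trans ?_) 2
    calc _ ≤ ∑ _i : Fin H, B := Finset.sum_le_sum fun i _ => hB _ _
      _ = H * B := by simp

/-- Change of trajectory measure: only state-action concentrability is needed to transfer the
expectation of a sum along the trajectory. -/
theorem sq_integral_cumulative_le (hp : IsPolicy p) (hq : IsPolicy q)
    (hf : ∀ a, Measurable fun s => f s a) {B : ℝ} (hB : ∀ s a, |f s a| ≤ B) {K : ℝ≥0∞}
    (hK : ∀ h, 1 + chiSqDiv (M.occupancy q h) (M.occupancy p h) ≤ K) (hK1 : 1 ≤ K) (hKt : K ≠ ∞) :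
    (∫ s, M.cumulative q f H s ∂M.init) ^ 2
      ≤ (1 + H) * (K.toReal * ∫ t, (∑ i, f (t i).1 (t i).2) ^ 2 ∂(M.trajLaw p)) := by
  have := M.isProbabilityMeasure_init
  have hK1' : 1 ≤ K.toReal := by
    simpa using ENNReal.toReal_mono hKt hK1
  have ham := M.measurable_advantage hp hf
  have hab := M.abs_advantage_le hp hB
  -- The value `none` indexes the start term and `some h` the advantage in layer `h`: Cauchy-Schwarz
  -- over these 1 + H terms gives the horizon factor.
  set x : Option (Fin H) → ℝ := fun o => o.elim (∫ s, M.cumulative p f H s ∂M.init)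
    fun h => ∫ x, M.advantage p f x.1 x.2 ∂(M.occupancy q h) with hx
  have h1 : ∫ s, M.cumulative q f H s ∂M.init = ∑ o, x o := by
    rw [Fintype.sum_option, hx]
    simp only [Option.elim]
    rw [← M.integral_cumulative_eq_sum_occupancy hq ham hab, ← integral_add]
    · refine integral_congr_ae ?_
      filter_upwards [M.ae_layer_add] with s hs
      rw [M.cumulative_advantage hq p f H s hs]
      ring
    · exact M.integrable_cumulative hp hf (fun s => hp.sum_mul_abs_le (hB s)) H
    · exact M.integrable_cumulative hq ham (fun s => hq.sum_mul_abs_le (hab s)) H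
  have h2 := sq_sum_le_card_mul_sum_sq (s := (Finset.univ : Finset (Option (Fin H)))) (f := x)
  rw [h1]
  refine h2.trans ?_
  have hcard : ((Finset.univ : Finset (Option (Fin H))).card : ℝ) = 1 + H := by
    simp [add_comm]
  rw [hcard]
  refine mul_le_mul_of_nonneg_left ?_ (by positivity)
  rw [M.integral_sq_trajLaw hp hf hB, Fintype.sum_option, mul_add, Finset.mul_sum]
  refine add_le_add ?_ (Finset.sum_le_sum fun h _ => ?_)
  -- Both policies share the initial law, so the start term needs only Jensen and K ≥ 1.
  · have hsq : Integrable (fun s => M.cumulative p f H s ^ 2) M.init := by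
      refine M.integrable_init_of_bound ((M.measurable_cumulative hp hf H).pow_const 2)
        (B := (H * B) ^ 2) fun s => ?_
      rw [abs_pow]
      exact pow_le_pow_left₀ (abs_nonneg _)
        (M.abs_cumulative_le_of_sum_le hp (fun s => hp.sum_mul_abs_le (hB s)) H s) 2
    refine le_trans ?_ (le_mul_of_one_le_left (integral_nonneg fun s => sq_nonneg _) hK1')
    have hi := M.integrable_cumulative hp hf (fun s => hp.sum_mul_abs_le (hB s)) H
    exact even_two.convexOn_pow.map_integral_le (continuous_pow 2).continuousOn isClosed_univ
      (Filter.Eventually.of_forall fun _ => Set.mem_univ _) hi hsq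
  · have := M.isProbabilityMeasure_occupancy hp h
    have := M.isProbabilityMeasure_occupancy hq h
    refine sq_integral_le_chiSqDiv_mul (measurable_pair ham) ?_ (hK h) hKt
    refine Integrable.of_bound ((measurable_pair ham).pow_const 2).aestronglyMeasurable
      ((B + H * B + H * B) ^ 2) (Filter.Eventually.of_forall fun x => ?_)
    rw [Real.norm_eq_abs, abs_pow]
    exact pow_le_pow_left₀ (abs_nonneg _) (hab _ _) 2

end ChangeOfMeasure

end DetMDP

/-! ### Nets in finite-dimensional normed spaces. -/

section Covering

open Metric Module

variable {E : Type*} [NormedAddCommGroup E] [NormedSpace ℝ E] [FiniteDimensional ℝ E]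

/-- Volume comparison: the balls of radius ε/2 around the points are disjoint and lie in a ball of
radius R + ε/2. -/
theorem card_le_of_separated_of_norm_le {R ε : ℝ} (hR : 0 ≤ R) (hε : 0 < ε) (s : Finset E)
    (hs : ∀ c ∈ s, ‖c‖ ≤ R) (h : ∀ c ∈ s, ∀ d ∈ s, c ≠ d → ε ≤ ‖c - d‖) :
    (s.card : ℝ) ≤ (1 + 2 * R / ε) ^ finrank ℝ E := by
  borelize E
  let μ : Measure E := Measure.addHaar
  have hδ : 0 < ε / 2 := by positivity
  have hρ : 0 < R + ε / 2 := by positivity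
  have hdisj : Set.Pairwise (s : Set E) (Function.onFun Disjoint fun c => ball (c : E) (ε / 2)) := by
    rintro c hc d hd hcd
    apply ball_disjoint_ball
    rw [dist_eq_norm, add_halves]
    exact h c hc d hd hcd
  have hsub : ⋃ c ∈ s, ball (c : E) (ε / 2) ⊆ ball (0 : E) (R + ε / 2) := by
    refine Set.iUnion₂_subset fun x hx => ball_subset_ball' ?_
    rw [dist_zero_right]
    linarith [hs x hx]
  have hvol : (s.card : ℝ≥0∞) * ENNReal.ofReal ((ε / 2) ^ finrank ℝ E) * μ (ball 0 1) ≤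
      ENNReal.ofReal ((R + ε / 2) ^ finrank ℝ E) * μ (ball 0 1) :=
    calc _ = μ (⋃ c ∈ s, ball (c : E) (ε / 2)) := by
          rw [measure_biUnion_finset hdisj fun c _ => measurableSet_ball]
          simp only [μ.addHaar_ball_of_pos _ hδ, Finset.sum_const, nsmul_eq_mul, mul_assoc]
      _ ≤ μ (ball (0 : E) (R + ε / 2)) := measure_mono hsub
      _ = _ := by simp only [μ.addHaar_ball_of_pos _ hρ]
  have h1 : (s.card : ℝ≥0∞) * ENNReal.ofReal ((ε / 2) ^ finrank ℝ E)
      ≤ ENNReal.ofReal ((R + ε / 2) ^ finrank ℝ E) :=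
    (ENNReal.mul_le_mul_iff_left (measure_ball_pos _ _ zero_lt_one).ne' measure_ball_lt_top.ne).1
      hvol
  have h2 := ENNReal.toReal_le_of_le_ofReal (pow_nonneg hρ.le _) h1
  rw [ENNReal.toReal_mul, ENNReal.toReal_natCast, ENNReal.toReal_ofReal (by positivity)] at h2
  rw [← le_div_iff₀ (by positivity), ← div_pow] at h2
  refine h2.trans_eq ?_
  congr 1
  field_simp
  ring

/-- A separated subset of maximal cardinality is a net. Its points lie in Θ itself, where the
assumptions on the logits hold. -/
theorem exists_finset_net {Θ : Set E} {R ε : ℝ} (hR : 0 ≤ R) (hε : 0 < ε)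
    (hΘ : ∀ θ ∈ Θ, ‖θ‖ ≤ R) :
    ∃ T : Finset E, (∀ θ ∈ T, θ ∈ Θ) ∧ (∀ θ ∈ Θ, ∃ θ' ∈ T, ‖θ - θ'‖ ≤ ε) ∧
      (T.card : ℝ) ≤ (1 + 2 * R / ε) ^ finrank ℝ E := by
  classical
  set P : Finset E → Prop := fun T =>
    (∀ θ ∈ T, θ ∈ Θ) ∧ ∀ c ∈ T, ∀ d ∈ T, c ≠ d → ε ≤ ‖c - d‖ with hP
  have hcard : ∀ T, P T → (T.card : ℝ) ≤ (1 + 2 * R / ε) ^ finrank ℝ E := fun T hT =>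
    card_le_of_separated_of_norm_le hR hε T (fun c hc => hΘ c (hT.1 c hc)) hT.2
  have hbdd : BddAbove {k | ∃ T, P T ∧ T.card = k} := by
    refine ⟨⌊(1 + 2 * R / ε) ^ finrank ℝ E⌋₊, ?_⟩
    rintro _ ⟨T, hT, rfl⟩
    exact Nat.le_floor (hcard T hT)
  obtain ⟨T, hT, hmax⟩ := Nat.sSup_mem (s := {k | ∃ T, P T ∧ T.card = k})
    ⟨0, ∅, by simp [hP], rfl⟩ hbdd
  refine ⟨T, hT.1, fun θ hθ => ?_, hcard T hT⟩
  by_contra! hfar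
  have hnot : θ ∉ T := fun h => by
    have := hfar θ h
    rw [sub_self, norm_zero] at this
    linarith
  have hins : P (insert θ T) := by
    refine ⟨fun x hx => ?_, fun c hc d hd hcd => ?_⟩
    · rcases Finset.mem_insert.1 hx with rfl | hx
      · exact hθ
      · exact hT.1 x hx
    · rcases Finset.mem_insert.1 hc with rfl | hc' <;>
        rcases Finset.mem_insert.1 hd with rfl | hd'
      · exact absurd rfl hcd
      · exact (hfar d hd').le
      · rw [norm_sub_rev]
        exact (hfar c hc').le
      · exact hT.2 c hc' d hd' hcd
  have := le_csSup hbdd ⟨insert θ T, hins, rfl⟩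
  rw [← hmax, Finset.card_insert_of_notMem hnot] at this
  omega

end Covering

/-! ### Lower-tail concentration. -/

section Concentration

/-- Passes through 1/(1 + x); the loss of 1/2 is the factor N/2 in the Chernoff bound. -/
theorem exp_neg_le_one_sub_half {x : ℝ} (h0 : 0 ≤ x) (h1 : x ≤ 1) : Real.exp (-x) ≤ 1 - x / 2 := by
  rw [Real.exp_neg]
  refine (inv_anti₀ (by linarith) (Real.add_one_le_exp x)).trans ?_
  rw [inv_le_iff_one_le_mul₀ (by linarith)]
  nlinarith

/-- The multiplicative Chernoff bound for the lower tail of a sum of nonnegative bounded i.i.d.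
random variables. -/
theorem measure_pi_sum_lt_le {X : Type*} [MeasurableSpace X] (μ : Measure X)
    [IsProbabilityMeasure μ] {Z : X → ℝ} (hZ : Measurable Z) {b : ℝ} (hb : 0 < b)
    (h0 : ∀ x, 0 ≤ Z x) (hle : ∀ᵐ x ∂μ, Z x ≤ b) (N : ℕ) (t : ℝ) :
    Measure.pi (fun _ : Fin N => μ) {D | ∑ i, Z (D i) + b * t < N / 2 * ∫ x, Z x ∂μ}
      ≤ ENNReal.ofReal (Real.exp (-t)) := by
  set m := ∫ x, Z x ∂μ
  set P := Measure.pi (fun _ : Fin N => μ)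
  have hZi : Integrable Z μ := Integrable.of_bound hZ.aestronglyMeasurable b (by
    filter_upwards [hle] with x hx
    rwa [Real.norm_of_nonneg (h0 x)])
  have hem : Measurable fun x => Real.exp (-(Z x / b)) :=
    Real.measurable_exp.comp (hZ.div_const b).neg
  have hei : Integrable (fun x => Real.exp (-(Z x / b))) μ :=
    Integrable.of_bound hem.aestronglyMeasurable 1 (Filter.Eventually.of_forall fun x => by
      rw [Real.norm_of_nonneg (Real.exp_pos _).le, Real.exp_le_one_iff]
      exact neg_nonpos.2 (div_nonneg (h0 x) hb.le))
  have h1 : ∫ x, Real.exp (-(Z x / b)) ∂μ ≤ Real.exp (-(m / (2 * b))) := by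
    calc _ ≤ ∫ x, (1 - Z x / b / 2) ∂μ := by
          refine integral_mono_ae hei ((integrable_const _).sub ((hZi.div_const b).div_const 2)) ?_
          filter_upwards [hle] with x hx
          exact exp_neg_le_one_sub_half (div_nonneg (h0 x) hb.le) ((div_le_one hb).2 hx)
      _ = -(m / (2 * b)) + 1 := by
          rw [integral_sub (integrable_const _) ((hZi.div_const b).div_const 2), integral_div,
            integral_div]
          simp only [integral_const, probReal_univ, smul_eq_mul, m]
          field_simp
          ring
      _ ≤ _ := Real.add_one_le_exp _
  have h2 : ∫ D, ∏ i, Real.exp (-(Z (D i) / b)) ∂P ≤ Real.exp (-(N * m / (2 * b))) := by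
    rw [integral_fintype_prod_eq_pow (ι := Fin N) (fun x => Real.exp (-(Z x / b))),
      Fintype.card_fin]
    refine (pow_le_pow_left₀ (integral_nonneg fun x => (Real.exp_pos _).le) h1 N).trans_eq ?_
    rw [← Real.exp_nat_mul]
    congr 1
    ring
  -- The bad event says that the product of exponentials exceeds `c`, and Markov's inequality then
  -- leaves exp(-t).
  set c := Real.exp (t - N * m / (2 * b)) with hc
  have hc0 : 0 < c := Real.exp_pos _
  have h3 := mul_meas_ge_le_integral_of_nonneg (μ := P)
    (f := fun D => ∏ i, Real.exp (-(Z (D i) / b)))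
    (Filter.Eventually.of_forall fun D => Finset.prod_nonneg fun i _ => (Real.exp_pos _).le)
    (Integrable.fintype_prod fun _ => hei) c
  have h4 : {D : Fin N → X | ∑ i, Z (D i) + b * t < N / 2 * m}
      ⊆ {D | c ≤ ∏ i, Real.exp (-(Z (D i) / b))} := fun D hD => by
    simp only [Set.mem_ofPred_eq] at hD ⊢
    rw [← Real.exp_sum, hc, Real.exp_le_exp, Finset.sum_neg_distrib, ← Finset.sum_div]
    have : N * m / (2 * b) = N / 2 * m / b := by field_simp
    rw [this, le_neg, neg_sub, ← sub_nonneg, ← mul_nonneg_iff_of_pos_left hb]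
    have h5 : b * (N / 2 * m / b - t - (∑ i, Z (D i)) / b)
        = N / 2 * m - (∑ i, Z (D i) + b * t) := by
      field_simp
      ring
    rw [h5]
    linarith
  have h6 : P.real {D | c ≤ ∏ i, Real.exp (-(Z (D i) / b))} ≤ Real.exp (-t) := by
    have h7 := h3.trans h2
    rw [← le_div_iff₀' hc0, hc, ← Real.exp_sub] at h7
    refine h7.trans_eq ?_
    congr 1
    ring
  refine (measure_mono h4).trans ?_
  rw [← ofReal_measureReal]
  exact ENNReal.ofReal_le_ofReal h6

end Concentration

/-! ### From Bellman residuals to suboptimality. -/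

namespace DetMDP

section Suboptimality

variable {S A : Type*} [MeasurableSpace S] [Fintype A] [MeasurableSpace A]
  [MeasurableSingletonClass A] {H : ℕ} (M : DetMDP S A H) {β : ℝ} {ref mu pstar Q Qstar : S → A → ℝ}

/-- Rewards and reference terms cancel in the difference. The first step contributes η, each later
one 2η through Q and its soft value. -/
theorem abs_trajResidual_sub_le [NeZero H] [Nonempty A] {Q Q' : S → A → ℝ} {η : ℝ}
    (h : ∀ s a, |Q s a - Q' s a| ≤ η) (t : Fin H → S × A) :
    |M.trajResidual β ref Q t - M.trajResidual β ref Q' t| ≤ H * (2 * η) := by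
  have hV := fun s => abs_softValue_sub_le (h s)
  have h0 : 0 ≤ η := (abs_nonneg _).trans (h (t 0).1 (t 0).2)
  have h1 : M.trajResidual β ref Q t - M.trajResidual β ref Q' t
      = (Q (t 0).1 (t 0).2 - Q' (t 0).1 (t 0).2)
        + ∑ i ∈ Finset.univ.erase (0 : Fin H), ((Q (t i).1 (t i).2 - Q' (t i).1 (t i).2)
          - (softValue Q (t i).1 - softValue Q' (t i).1)) := by
    simp only [trajResidual, log_boltzmann, Finset.sum_sub_distrib]
    ring
  rw [h1]
  have h2 : |∑ i ∈ Finset.univ.erase (0 : Fin H), ((Q (t i).1 (t i).2 - Q' (t i).1 (t i).2)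
      - (softValue Q (t i).1 - softValue Q' (t i).1))|
      ≤ ∑ _i ∈ Finset.univ.erase (0 : Fin H), 2 * η :=
    (Finset.abs_sum_le_sum_abs _ _).trans (Finset.sum_le_sum fun i _ =>
      (abs_sub _ _).trans ((add_le_add (h _ _) (hV _)).trans_eq (two_mul η).symm))
  have h3 := Finset.add_sum_erase Finset.univ (fun _ : Fin H => 2 * η) (Finset.mem_univ 0)
  have h4 : ∑ _i : Fin H, 2 * η = H * (2 * η) := by simp
  rw [h4] at h3
  refine (abs_add_le _ _).trans ?_
  linarith [h (t 0).1 (t 0).2]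

theorem abs_bellmanError_le [Nonempty A] {B B' : ℝ} (hQB : ∀ s a, |Q s a| ≤ B)
    (hR : ∀ s a, |M.shiftedReward β ref s a| ≤ B') (s : S) (a : A) :
    |M.bellmanError β ref Q s a| ≤ B + B' + (B + Real.log (Fintype.card A)) := by
  have h0 : 0 ≤ B := (abs_nonneg _).trans (hQB s a)
  have hl : 0 ≤ Real.log (Fintype.card A) := Real.log_natCast_nonneg _
  refine (abs_sub _ _).trans (add_le_add ((abs_sub _ _).trans (add_le_add (hQB s a) (hR s a))) ?_)
  rw [nextStep]
  split_ifs
  · exact abs_softValue_le (hQB _)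
  · rw [abs_zero]
    positivity

/-- The suboptimality of a Boltzmann policy is controlled by the mean squared trajectory Bellman
residual of its logits under the data collection policy. -/
theorem objective_sub_le [NeZero H] [Nonempty A] (hβ : 0 < β) (href : IsPolicy ref)
    (hpos : ∀ s a, 0 < ref s a) (hmu : IsPolicy mu) (hopt : M.IsOptimal β ref pstar)
    (hQsm : ∀ a, Measurable fun s => Qstar s a) (hQs : ∀ s a, Qstar s a = M.qValue β ref pstar s a)
    (hQm : ∀ a, Measurable fun s => Q s a) {B : ℝ} (hQsB : ∀ s a, |Qstar s a| ≤ B)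
    (hQB : ∀ s a, |Q s a| ≤ B) {K : ℝ≥0∞}
    (hK : ∀ h, 1 + chiSqDiv (M.occupancy (boltzmann Q) h) (M.occupancy mu h) ≤ K)
    (hKs : ∀ h, 1 + chiSqDiv (M.occupancy (boltzmann Qstar) h) (M.occupancy mu h) ≤ K)
    (hK1 : 1 ≤ K) (hKt : K ≠ ∞) :
    M.objective β ref pstar - M.objective β ref (boltzmann Q)
      ≤ 2 * β * √((1 + H) * (K.toReal * ∫ t, M.trajResidual β ref Q t ^ 2 ∂(M.trajLaw mu))) := by
  have hb := isPolicy_boltzmann hQm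
  have hbs := isPolicy_boltzmann hQsm
  have hR := M.abs_shiftedReward_le_of_qValue href hopt.1 hQs hQsB
  have hem := M.measurable_bellmanError href β hQm
  have heB := M.abs_bellmanError_le hQB hR
  have hV : Integrable (softValue Q) M.init :=
    M.integrable_init_of_bound (measurable_softValue hQm) fun s => abs_softValue_le (hQB s)
  have hi : ∀ {q : S → A → ℝ}, IsPolicy q →
      Integrable (M.cumulative q (M.bellmanError β ref Q) H) M.init := fun hq =>
    M.integrable_cumulative hq hem (fun s => hq.sum_mul_abs_le (heB s)) H
  have h1 : M.objective β ref (boltzmann Q) = β * (∫ s, softValue Q s ∂M.init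
      - ∫ s, M.cumulative (boltzmann Q) (M.bellmanError β ref Q) H s ∂M.init) := by
    rw [M.objective_eq hβ href hpos hb hR, ← integral_sub hV (hi hb)]
    congr 1
    refine integral_congr_ae ?_
    filter_upwards [M.ae_layer_add] with s hs
    exact M.cumulative_entropy_boltzmann hQm β ref H s hs
  have h2 : M.objective β ref pstar ≤ β * (∫ s, softValue Q s ∂M.init
      - ∫ s, M.cumulative (boltzmann Qstar) (M.bellmanError β ref Q) H s ∂M.init) := by
    -- The comparator is switched from `pstar` to the Boltzmann policy of `Qstar`: same objective,
    -- but `hKs` controls its occupancies.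
    rw [← (M.objective_boltzmann_eq_and_cumulative_eq_zero hβ href hpos hopt hQsm hQs hQsB).1,
      M.objective_eq hβ href hpos hbs hR, ← integral_sub hV (hi hbs)]
    refine mul_le_mul_of_nonneg_left (integral_mono_ae ?_ (hV.sub (hi hbs)) ?_) hβ.le
    · exact M.integrable_cumulative hbs (M.measurable_entropyReward href hbs)
        (fun s => hbs.sum_mul_abs_sub_log_le (hR s)) H
    · filter_upwards [M.ae_layer_add] with s hs
      exact M.cumulative_entropy_le hbs β ref Q H s hs
  have h3 : ∫ t, M.trajResidual β ref Q t ^ 2 ∂(M.trajLaw mu)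
      = ∫ t, (∑ i, M.bellmanError β ref Q (t i).1 (t i).2) ^ 2 ∂(M.trajLaw mu) := by
    refine integral_congr_ae ?_
    filter_upwards [M.ae_trajResidual_eq (β := β) href hmu hQm] with t ht
    rw [ht]
  have h4 := Real.abs_le_sqrt (M.sq_integral_cumulative_le hmu hb hem heB hK hK1 hKt)
  have h5 := Real.abs_le_sqrt (M.sq_integral_cumulative_le hmu hbs hem heB hKs hK1 hKt)
  rw [← h3] at h4 h5
  set r := √((1 + H) * (K.toReal * ∫ t, M.trajResidual β ref Q t ^ 2 ∂(M.trajLaw mu)))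
  rw [h1]
  have h6 := mul_le_mul_of_nonneg_left (add_le_add (abs_le.1 h4).2 (neg_le.1 (abs_le.1 h5).1)) hβ.le
  linarith

end Suboptimality

end DetMDP

/-! ### Union bound, constants and the main theorem. -/

theorem nonempty_of_isPolicy {S A : Type*} [MeasurableSpace S] [Fintype A] {p : S → A → ℝ}
    (hp : IsPolicy p) (s : S) : Nonempty A := by
  by_contra h
  have := not_nonempty_iff.1 h
  simpa using hp.sum_eq_one s

/-- The net has radius η/L; for L = 0 a single point suffices. -/
theorem exists_finset_net_of_radius {E : Type*} [NormedAddCommGroup E] [NormedSpace ℝ E]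
    [FiniteDimensional ℝ E] {Θ : Set E} {L R η u : ℝ} (hΘ : ∀ θ ∈ Θ, ‖θ‖ ≤ R) (hL : 0 ≤ L)
    (hR : 0 ≤ R) (hη : 0 < η) (hne : Θ.Nonempty) (hu : 2 * R * L / η ≤ u) :
    ∃ T : Finset E, (∀ θ ∈ T, θ ∈ Θ) ∧ (∀ θ ∈ Θ, ∃ θ' ∈ T, L * ‖θ - θ'‖ ≤ η) ∧
      (T.card : ℝ) ≤ (1 + u) ^ Module.finrank ℝ E := by
  have hu0 : 0 ≤ 2 * R * L / η := by positivity
  rcases hL.eq_or_lt with rfl | hL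
  · obtain ⟨θ₀, h₀⟩ := hne
    refine ⟨{θ₀}, by simpa using h₀, fun θ _ => ⟨θ₀, by simp, by simpa using hη.le⟩, ?_⟩
    rw [Finset.card_singleton, Nat.cast_one]
    exact one_le_pow₀ (by linarith)
  · obtain ⟨T, h1, h2, h3⟩ := exists_finset_net hR (div_pos hη hL) hΘ
    refine ⟨T, h1, fun θ hθ => ?_, h3.trans (pow_le_pow_left₀ (by positivity) ?_ _)⟩
    · obtain ⟨θ', hθ', h⟩ := h2 θ hθ
      exact ⟨θ', hθ', by rwa [mul_comm, ← le_div_iff₀ hL]⟩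
    · rw [div_div_eq_mul_div]
      linarith

theorem ae_pi_of_ae {X : Type*} [MeasurableSpace X] {μ : Measure X} [IsProbabilityMeasure μ]
    {P : X → Prop} (h : ∀ᵐ x ∂μ, P x) (N : ℕ) :
    Measure.pi (fun _ : Fin N => μ) {D | ¬ ∀ i, P (D i)} = 0 := by
  rw [← ae_iff, ae_all_iff]
  exact fun i => (Measure.quasiMeasurePreserving_eval (fun _ : Fin N => μ) i).ae h

/-- Deterministic comparison of the mean squared residual of `f` with its empirical counterpart,
through a nearby function `g`. -/
theorem integral_sq_le_of_close {X : Type*} [MeasurableSpace X] {μ : Measure X}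
    [IsProbabilityMeasure μ] {f g : X → ℝ} (hfi : Integrable (fun x => f x ^ 2) μ)
    (hgi : Integrable (fun x => g x ^ 2) μ) {κ b t : ℝ}
    (hfg : ∀ x, |f x - g x| ≤ κ) {N : ℕ} (hN : 0 < N) (D : Fin N → X)
    (hD : N / 2 * ∫ x, g x ^ 2 ∂μ ≤ ∑ i, g (D i) ^ 2 + b * t) :
    ∫ x, f x ^ 2 ∂μ ≤ 8 * (1 / N * ∑ i, f (D i) ^ 2) + 10 * κ ^ 2 + 4 * (b * t / N) := by
  have hN' : (0 : ℝ) < N := by exact_mod_cast hN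
  have hsq : ∀ x, (f x - g x) ^ 2 ≤ κ ^ 2 := fun x => sq_le_sq' (by linarith [(abs_le.1 (hfg x)).1])
    (abs_le.1 (hfg x)).2
  have h1 : ∫ x, f x ^ 2 ∂μ ≤ 2 * ∫ x, g x ^ 2 ∂μ + 2 * κ ^ 2 := by
    have : ∫ x, (2 * g x ^ 2 + 2 * κ ^ 2) ∂μ = 2 * ∫ x, g x ^ 2 ∂μ + 2 * κ ^ 2 := by
      rw [integral_add (hgi.const_mul 2) (integrable_const _), integral_const_mul]
      simp
    rw [← this]
    refine integral_mono hfi ((hgi.const_mul 2).add (integrable_const _)) fun x => ?_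
    show f x ^ 2 ≤ 2 * g x ^ 2 + 2 * κ ^ 2
    nlinarith [hsq x, sq_nonneg (f x - 2 * g x)]
  have h2 : ∑ i, g (D i) ^ 2 ≤ 2 * ∑ i, f (D i) ^ 2 + N * (2 * κ ^ 2) := by
    have : N * (2 * κ ^ 2) = ∑ _i : Fin N, 2 * κ ^ 2 := by simp
    rw [this, Finset.mul_sum, ← Finset.sum_add_distrib]
    exact Finset.sum_le_sum fun i _ => by nlinarith [hsq (D i), sq_nonneg (g (D i) - 2 * f (D i))]
  have h3 : ∫ x, g x ^ 2 ∂μ ≤ 2 / N * (2 * ∑ i, f (D i) ^ 2 + N * (2 * κ ^ 2) + b * t) := by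
    rw [div_mul_eq_mul_div, le_div_iff₀ hN']
    linarith
  -- Two quadratic comparisons and the Chernoff factor 2 give 2·2·2 = 8, 2·2·2 + 2 = 10 and 2·2 = 4.
  calc _ ≤ _ := h1
    _ ≤ 2 * (2 / N * (2 * ∑ i, f (D i) ^ 2 + N * (2 * κ ^ 2) + b * t)) + 2 * κ ^ 2 := by linarith
    _ = _ := by
      field_simp
      ring

theorem net_card_mul_exp_le {n : ℕ} {k u δ : ℝ} (hu : 0 ≤ u) (hδ : 0 < δ) (hk : k ≤ (1 + u) ^ n) :
    k * Real.exp (-(n * Real.log (1 + u) - Real.log δ)) ≤ δ := by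
  have h1 : Real.exp (-(n * Real.log (1 + u) - Real.log δ)) = δ / (1 + u) ^ n := by
    rw [neg_sub, Real.exp_sub, Real.exp_log hδ, ← Real.log_pow, Real.exp_log (by positivity)]
  rw [h1, mul_div_assoc', div_le_iff₀ (by positivity), mul_comm δ]
  exact mul_le_mul_of_nonneg_right hk hδ.le

/-- The factor e makes the logarithm at least 1, so that the discretization error can be absorbed;
this requires n ≥ 1. -/
theorem log_budget_le {n : ℕ} (hn : 1 ≤ n) {u δ : ℝ} (hu : 0 ≤ u) (hδ : 0 < δ) (hδ1 : δ < 1) :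
    n * Real.log (1 + u) - Real.log δ ≤ n * Real.log (Real.exp 1 * (1 + u) / δ) ∧
      1 ≤ n * Real.log (Real.exp 1 * (1 + u) / δ) := by
  have hn' : (1 : ℝ) ≤ n := by exact_mod_cast hn
  have h1 : Real.log (Real.exp 1 * (1 + u) / δ) = 1 + Real.log (1 + u) - Real.log δ := by
    rw [Real.log_div (by positivity) hδ.ne', Real.log_mul (Real.exp_pos 1).ne' (by positivity),
      Real.log_exp]
  have h2 : Real.log δ ≤ 0 := Real.log_nonpos hδ.le hδ1.le
  have h3 : 0 ≤ Real.log (1 + u) := Real.log_nonneg (by linarith)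
  rw [h1]
  constructor <;> nlinarith

/-- Here 224 = 160 + 64 combines net and Chernoff errors, and 4(1 + H)·224 ≤ 1792 H ≤ 50² H. -/
theorem final_bound_le {β C H d N Λ K ε m : ℝ} (hβ : 0 < β) (hH : 1 ≤ H)
    (hN : 1 ≤ N) (hK : 0 ≤ K) (hε : 0 ≤ ε) {t : ℝ} (ht : t ≤ d * Λ) (hΛ : 1 ≤ d * Λ)
    (hm : m ≤ 8 * ε + 10 * (H * (2 * (2 * C / (β * N)))) ^ 2
      + 4 * ((H * (2 * (2 * C / β))) ^ 2 * t / N)) :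
    2 * β * √((1 + H) * (K * m))
      ≤ 50 * √(H * K * (β ^ 2 * ε + C ^ 2 * (H ^ 2 * d / N) * Λ)) := by
  have hN0 : 0 < N := by linarith
  have hm2 : β ^ 2 * m ≤ 224 * (β ^ 2 * ε + C ^ 2 * (H ^ 2 * d / N) * Λ) := by
    have h1 : β ^ 2 * (10 * (H * (2 * (2 * C / (β * N)))) ^ 2) = 160 * (C * H) ^ 2 / N / N := by
      field_simp
      ring
    have h2 : β ^ 2 * (4 * ((H * (2 * (2 * C / β))) ^ 2 * t / N)) = 64 * (C * H) ^ 2 / N * t := by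
      field_simp
      ring
    have h3 : C ^ 2 * (H ^ 2 * d / N) * Λ = (C * H) ^ 2 / N * (d * Λ) := by
      field_simp
    have h4 : 0 ≤ (C * H) ^ 2 / N := by positivity
    have h5 : 160 * (C * H) ^ 2 / N / N ≤ 160 * ((C * H) ^ 2 / N) := by
      rw [mul_div_assoc]
      exact div_le_self (by positivity) hN
    have h6 := mul_le_mul_of_nonneg_left ht h4
    have h7 := mul_le_mul_of_nonneg_left hΛ h4
    have h8 := mul_le_mul_of_nonneg_left hm (sq_nonneg β)
    have h9 : 0 ≤ β ^ 2 * ε := by positivity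
    rw [h3]
    rw [mul_add, mul_add, h1, h2] at h8
    have h10 : 64 * (C * H) ^ 2 / N * t = 64 * ((C * H) ^ 2 / N * t) := by ring
    rw [h10] at h8
    linarith
  set X := β ^ 2 * ε + C ^ 2 * (H ^ 2 * d / N) * Λ
  have hX : (2 * β) ^ 2 * ((1 + H) * (K * m)) ≤ 50 ^ 2 * (H * K * X) := by
    by_cases hX0 : 0 ≤ X
    · have h1 := mul_le_mul_of_nonneg_left hm2 (show 0 ≤ 4 * (1 + H) * K by positivity)
      have h2 : 0 ≤ K * X := mul_nonneg hK hX0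
      nlinarith
    · exfalso
      apply hX0
      have h3 : X = β ^ 2 * ε + (C * H) ^ 2 / N * (d * Λ) := by
        simp only [X]
        field_simp
      rw [h3]
      have : 0 ≤ d * Λ := by linarith
      positivity
  rw [← Real.sqrt_sq (show 0 ≤ 2 * β by positivity), ← Real.sqrt_mul (sq_nonneg _),
    ← Real.sqrt_sq (show (0 : ℝ) ≤ 50 by norm_num), ← Real.sqrt_mul (sq_nonneg _)]
  exact Real.sqrt_le_sqrt hX

theorem mainTheorem1 :
    ∃ c : ℝ, 0 < c ∧
      ∀ (S A : Type*) [MeasurableSpace S] [Fintype A] [MeasurableSpace A]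
        [MeasurableSingletonClass A] (H : ℕ) [NeZero H] (M : DetMDP S A H)
        (β : ℝ) (ref mu pstar : S → A → ℝ)
        (E : Type*) [NormedAddCommGroup E] [NormedSpace ℝ E] [FiniteDimensional ℝ E]
        (Θ : Set E) (logit : E → S → A → ℝ) (C L R : ℝ) (N : ℕ) (δ : ℝ),
        0 < β → IsPolicy ref → IsPolicy mu → M.IsOptimal β ref pstar →
        (∀ θ ∈ Θ, ∀ a, Measurable fun s => logit θ s a) →
        -- realizability
        (∃ θ ∈ Θ, ∀ s a, logit θ s a = M.qValue β ref pstar s a) →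
        -- bounded and smooth parametrization
        1 ≤ C →
        (∀ θ ∈ Θ, ∀ s a, |logit θ s a| ≤ C / β) →
        (∀ s a, ∀ θ ∈ convexHull ℝ Θ, ∃ g : E →L[ℝ] ℝ,
          HasFDerivWithinAt (fun ϑ => logit ϑ s a) g (convexHull ℝ Θ) θ ∧ ‖g‖ ≤ L) →
        (∀ s a, 0 < ref s a ∧ |Real.log (ref s a)| ≤ C / β) →
        -- parametric class
        (∀ θ ∈ Θ, ‖θ‖ ≤ R) →
        M.concentrability logit Θ mu ≠ ∞ →
        0 < N → 0 < δ → δ < 1 →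
        -- the data are `N` i.i.d. trajectories; the bad event has probability at most `δ`
        Measure.pi (fun _ : Fin N => M.trajLaw mu)
          {D | ¬ ∀ θhat ∈ Θ, ∀ εopt : ℝ,
            M.tbrmLoss β ref D (logit θhat) - (⨅ θ : Θ, M.tbrmLoss β ref D (logit θ)) ≤ εopt →
            M.objective β ref pstar - M.objective β ref (boltzmann (logit θhat)) ≤
              c * √(H * (M.concentrability logit Θ mu).toReal *
                (β ^ 2 * εopt + C ^ 2 * (H ^ 2 * Module.finrank ℝ E / N) *
                  Real.log (Real.exp 1 * (1 + R * L * β * H * N) / δ)))}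
          ≤ ENNReal.ofReal δ := by
  refine ⟨50, by norm_num, ?_⟩
  intro S A _ _ _ _ H _ M β ref mu pstar E _ _ _ Θ logit C L R N δ hβ href hmu hopt hmeas hreal hC
    hbound hsmooth hrefb hradius hconc hN hδ hδ1
  have := M.isProbabilityMeasure_init
  have := M.isProbabilityMeasure_trajLaw hmu
  obtain ⟨s₀⟩ := M.init.nonempty_of_neZero
  have : Nonempty A := nonempty_of_isPolicy hmu s₀
  obtain ⟨a₀⟩ := id this
  obtain ⟨θs, hθs, hQs⟩ := hreal
  have hpos : ∀ s a, 0 < ref s a := fun s a => (hrefb s a).1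
  have hR : 0 ≤ R := (norm_nonneg _).trans (hradius θs hθs)
  have hL : 0 ≤ L := by
    obtain ⟨g, -, hg⟩ := hsmooth s₀ a₀ θs (subset_convexHull ℝ Θ hθs)
    exact (norm_nonneg _).trans hg
  have hH : (1 : ℝ) ≤ H := by exact_mod_cast NeZero.pos H
  have hN1 : (1 : ℝ) ≤ N := by exact_mod_cast hN
  have hC0 : 0 < C := by linarith
  set K := M.concentrability logit Θ mu
  have hK1 : 1 ≤ K := le_self_add
  have hK : ∀ θ ∈ Θ, ∀ h, 1 + chiSqDiv (M.occupancy (boltzmann (logit θ)) h) (M.occupancy mu h) ≤ K :=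
    fun θ hθ h => add_le_add le_rfl (le_trans (le_iSup (fun h : Fin H =>
      chiSqDiv (M.occupancy (boltzmann (logit θ)) h) (M.occupancy mu h)) h)
      (le_iSup₂ (f := fun (θ : E) (_ : θ ∈ Θ) => ⨆ h : Fin H,
        chiSqDiv (M.occupancy (boltzmann (logit θ)) h) (M.occupancy mu h)) θ hθ))
  set res : E → (Fin H → S × A) → ℝ := fun θ => M.trajResidual β ref (logit θ) with hres
  have hresm : ∀ θ ∈ Θ, Measurable (res θ) := fun θ hθ => M.measurable_trajResidual href (hmeas θ hθ)
  have hres0 : ∀ᵐ t ∂M.trajLaw mu, res θs t = 0 :=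
    M.ae_trajResidual_eq_zero hβ href hpos hopt hmu (hmeas θs hθs) hQs (hbound θs hθs)
  set b := H * (2 * (2 * C / β)) with hb
  have hb0 : 0 < b := by positivity
  -- Comparison with the vanishing residual of θ* avoids both a reward bound and a log |A| term.
  have hresb : ∀ θ ∈ Θ, ∀ᵐ t ∂M.trajLaw mu, res θ t ^ 2 ≤ b ^ 2 := fun θ hθ => by
    filter_upwards [hres0] with t ht
    have h1 := M.abs_trajResidual_sub_le (β := β) (ref := ref) (Q := logit θ) (Q' := logit θs)
      (η := 2 * C / β) (fun s a => ?_) t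
    · change |res θ t - res θs t| ≤ b at h1
      rw [ht, sub_zero] at h1
      exact sq_le_sq' (abs_le.1 h1).1 (abs_le.1 h1).2
    · refine (abs_sub _ _).trans ((add_le_add (hbound θ hθ s a) (hbound θs hθs s a)).trans_eq ?_)
      ring
  have hresi : ∀ θ ∈ Θ, Integrable (fun t => res θ t ^ 2) (M.trajLaw mu) := fun θ hθ =>
    Integrable.of_bound ((hresm θ hθ).pow_const 2).aestronglyMeasurable (b ^ 2) (by
      filter_upwards [hresb θ hθ] with t ht
      rwa [Real.norm_of_nonneg (sq_nonneg _)])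
  have hlip : ∀ θ ∈ Θ, ∀ θ' ∈ Θ, ∀ s a, |logit θ s a - logit θ' s a| ≤ L * ‖θ - θ'‖ :=
    fun θ hθ θ' hθ' s a => by
      choose! g hg using hsmooth s a
      exact Convex.norm_image_sub_le_of_norm_hasFDerivWithin_le (f := fun ϑ => logit ϑ s a)
        (fun ϑ hϑ => (hg ϑ hϑ).1) (fun ϑ hϑ => (hg ϑ hϑ).2) (convex_convexHull ℝ Θ)
        (subset_convexHull ℝ Θ hθ') (subset_convexHull ℝ Θ hθ)
  set u := R * L * β * H * N with hu
  have hu0 : 0 ≤ u := by positivity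
  obtain ⟨T, hTΘ, hTnet, hTcard⟩ := exists_finset_net_of_radius (L := L) (R := R)
    (η := 2 * C / (β * N)) (u := u) hradius hL hR (by positivity) ⟨θs, hθs⟩ (by
      have h1 : 2 * R * L / (2 * C / (β * N)) = R * L * β * N / C := by
        field_simp
      rw [h1]
      refine (div_le_self (by positivity) hC).trans ?_
      have h2 : 0 ≤ R * L * β * N := by positivity
      calc R * L * β * N ≤ (R * L * β * N) * H := le_mul_of_one_le_right h2 hH
        _ = u := by rw [hu]; ring)
  set n := Module.finrank ℝ E with hn
  set t := n * Real.log (1 + u) - Real.log δ with ht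
  have hsub : {D | ¬ ∀ θhat ∈ Θ, ∀ εopt : ℝ,
      M.tbrmLoss β ref D (logit θhat) - (⨅ θ : Θ, M.tbrmLoss β ref D (logit θ)) ≤ εopt →
      M.objective β ref pstar - M.objective β ref (boltzmann (logit θhat)) ≤
        50 * √(H * K.toReal * (β ^ 2 * εopt + C ^ 2 * (H ^ 2 * n / N) *
          Real.log (Real.exp 1 * (1 + u) / δ)))}
      ⊆ (⋃ θ ∈ T, {D : Fin N → Fin H → S × A | ∑ i, res θ (D i) ^ 2 + b ^ 2 * t
          < N / 2 * ∫ x, res θ x ^ 2 ∂(M.trajLaw mu)}) ∪ {D | ¬ ∀ i, res θs (D i) = 0} := by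
    intro D hbad
    by_contra hD
    refine hbad ?_
    clear hbad
    simp only [Set.mem_union, Set.mem_iUnion, Set.mem_ofPred_eq, not_or, not_exists, not_lt,
      not_not] at hD ⊢
    obtain ⟨hDT, hD0⟩ := hD
    intro θ hθ ε hε
    -- In dimension 0 the main term vanishes, but then θ = θ* and the suboptimality is exactly zero.
    rcases Nat.eq_zero_or_pos n with hn0 | hn1
    · have := Module.finrank_zero_iff.1 hn0
      rw [Subsingleton.elim θ θs, (M.objective_boltzmann_eq_and_cumulative_eq_zero hβ href hpos hopt
        (hmeas θs hθs) hQs (hbound θs hθs)).1, sub_self]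
      positivity
    have hlossnn : ∀ θ, 0 ≤ M.tbrmLoss β ref D (logit θ) := fun θ =>
      mul_nonneg (by positivity) (Finset.sum_nonneg fun i _ => sq_nonneg _)
    have hbdd : BddBelow (Set.range fun θ : Θ => M.tbrmLoss β ref D (logit θ)) :=
      ⟨0, by rintro _ ⟨θ, rfl⟩; exact hlossnn θ⟩
    -- On the good event θ* fits the data exactly, so `ε` bounds the empirical loss itself and not
    -- only its excess.
    have hinf : (⨅ θ : Θ, M.tbrmLoss β ref D (logit θ)) ≤ 0 := by
      refine (ciInf_le hbdd ⟨θs, hθs⟩).trans_eq ?_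
      have h1 : ∀ i, M.trajResidual β ref (logit θs) (D i) = 0 := hD0
      simp [DetMDP.tbrmLoss, h1]
    have hε0 : 0 ≤ ε := by
      have := ciInf_le hbdd ⟨θ, hθ⟩
      simp only at this
      linarith
    have hloss : 1 / (N : ℝ) * ∑ i, res θ (D i) ^ 2 ≤ ε := by
      change M.tbrmLoss β ref D (logit θ) ≤ ε
      linarith
    obtain ⟨θ', hθ', hclose⟩ := hTnet θ hθ
    have hm := integral_sq_le_of_close (hresi θ hθ) (hresi θ' (hTΘ θ' hθ'))
      (κ := H * (2 * (2 * C / (β * N))))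
      (M.abs_trajResidual_sub_le fun s a =>
        (hlip θ hθ θ' (hTΘ θ' hθ') s a).trans hclose) hN D (hDT θ' hθ')
    obtain ⟨hb1, hb2⟩ := log_budget_le hn1 hu0 hδ hδ1
    refine (M.objective_sub_le hβ href hpos hmu hopt (hmeas θs hθs) hQs (hmeas θ hθ)
      (hbound θs hθs) (hbound θ hθ) (hK θ hθ) (hK θs hθs) hK1 hconc).trans ?_
    exact final_bound_le hβ hH hN1 ENNReal.toReal_nonneg hε0 hb1 hb2 (by linarith)
  -- Monotonicity and subadditivity hold for arbitrary sets, so the bad event need not be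
  -- measurable.
  refine (measure_mono hsub).trans ((measure_union_le _ _).trans ?_)
  rw [ae_pi_of_ae hres0, add_zero]
  refine (measure_biUnion_finset_le _ _).trans ?_
  refine (Finset.sum_le_sum fun θ hθ => measure_pi_sum_lt_le (M.trajLaw mu)
    ((hresm θ (hTΘ θ hθ)).pow_const 2) (by positivity : 0 < b ^ 2) (fun _ => sq_nonneg _)
    (hresb θ (hTΘ θ hθ)) N t).trans ?_
  rw [Finset.sum_const, nsmul_eq_mul, ← ENNReal.ofReal_natCast,
    ← ENNReal.ofReal_mul (Nat.cast_nonneg _)]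
  exact ENNReal.ofReal_le_ofReal (net_card_mul_exp_le hu0 hδ hTcard)
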